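/- **Setting.** Let $n\ge 2$ and let $\{G(t)\}_{t\ge0}$ be directed graphs on $\{1,\dots,n\}$ that are $B$-strongly-connected: $B\ge1$ is an integer and, for each $k\ge0$, the union of the edge sets of $G(kB),\dots,G((k+1)B-1)$ is strongly connected. Each node counts as an in- and out-neighbor of itself; $N_i^{\rm in}(t)$ is the in-neighborhood of $i$ and $d_i(t)$ the out-degree of $i$ in $G(t)$ (both with $i$ included). Let $A(t)$ be the matrix with $A_{ij}(t)=1/d_j(t)$ if $j\in N_i^{\rm in}(t)$ and $A_{ij}(t)=0$ otherwise, and let $\sigma_2(A)$ be the second-largest singular value of $A$. Let $f_i:\mathbb R^d\to\mathbb R$ be $\mu_i$-strongly convex with $\mu_i>0$ ($i=1,\dots,n$), let $F=\sum_i f_i$, and let $\mathbf z^*$ be the unique minimizer of $F$ (which exists). The stochastic subgradient-push method starts from arbitrary deterministic $\mathbf x_i(0)\in\mathbb R^d$ and $y_i(0)=1$, and for $t\ge0$ sets $$\mathbf w_i(t+1)=\sum_{j\in N_i^{\rm in}(t)}\frac{\mathbf x_j(t)}{d_j(t)},\quad y_i(t+1)=\sum_{j\in N_i^{\rm in}(t)}\frac{y_j(t)}{d_j(t)},\quad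 \mathbf z_i(t+1)=\frac{\mathbf w_i(t+1)}{y_i(t+1)},$$ $$\mathbf x_i(t+1)=\mathbf w_i(t+1)-\alpha(t+1)\,\mathbf g_i(t+1).$$ Here $\mathbf g_i(t+1)=\nabla f_i(\mathbf z_i(t+1))+\mathbf N_i(\mathbf z_i(t+1))$, where $\nabla f_i(\mathbf u)$ is a (measurably chosen) subgradient of $f_i$ at $\mathbf u$ and the noise has the form $\mathbf N_i(\mathbf u)=\mathbf N_i(\mathbf u,\xi_i(t+1))$ with samples $\xi_i(t)$ that are independent over all nodes $i$ and times $t$, with $\mathbb E[\mathbf N_i(\mathbf u,\xi_i(t))]=0$ for all $\mathbf u\in\mathbb R^d$, $t\ge1$, and, with probability one, $\|\mathbf N_i(\mathbf u,\xi_i(t))\|\le c_i$ for all $\mathbf u\in\mathbb R^d$. For $t\ge2$ let $$\widehat{\mathbf z}_i(t)=\frac{\sum_{s=1}^{t}(s-1)\mathbf z_i(s)}{t(t-1)/2}.$$ **Theorem.** There are scalars $\delta>0$ and $\lambda\in[0,1)$ that depend only on the graph sequence $\{G(t)\}$ (and $B$), with $$\delta\ge\frac1{n^{nB}},\qquad \lambda\le\Bigl(1-\frac1{n^{nB}}\Bigr)^{1/(nB)},$$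 and, if every $G(t)$ is regular (all in-degrees and out-degrees of $G(t)$ are equal), moreover $$\delta=1,\qquad \lambda\le\min\Bigl\{\Bigl(1-\frac1{4n^3}\Bigr)^{1/B},\ \max_{t\ge0}\sigma_2(A(t))\Bigr\},$$ where $\lambda>0$ except possibly when every $G(t)$ is regular and $\max_{t}\sigma_2(A(t))=0$, such that the following holds for all data as above. Suppose that $\alpha(t)=p/t$ for $t\ge1$ with $p\,\frac{\sum_{i=1}^n\mu_i}{n}\ge4$, and that there is a scalar $D$ with $\sup_{t\ge1}\|\mathbf z_i(t)\|\le D$ for all $i$ with probability one. Then for all $i=1,\dots,n$ and all $\tau\ge2$, $$\mathbb E\Bigl[F(\widehat{\mathbf z}_i(\tau))-F(\mathbf z^*)+\sum_{j=1}^n\mu_j\|\widehat{\mathbf z}_j(\tau)-\mathbf z^*\|^2\Bigr]\le\frac{80L}{\tau\delta}\,\frac{\lambda}{1-\lambda}\sum_{j=1}^n\|\mathbf x_j(0)\|_1+\frac{80\,p\,L\,n\max_jB_j}{\tau\delta(1-\lambda)}\bigl(1+\ln(\tau-1)\bigr)+\frac p\tau\sum_{j=1}^n(L_j+c_j)^2,$$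 where $L_j$ is the largest Euclidean norm of a subgradient of $f_j$ on the ball of radius $D$ around the origin, $L=\sum_{j=1}^nL_j$ and $B_j=\sqrt d\,(L_j+c_j)$. -/

import Mathlib

open MeasureTheory ProbabilityTheory

/-! ### Time-varying directed graphs -/

section Graphs

variable {n : ℕ}

open Classical in
/-- In-neighborhood of `i`; by convention every node is an in-neighbor of itself. -/
noncomputable def inNbrs (G : Digraph (Fin n)) (i : Fin n) : Finset (Fin n) :=
  Finset.univ.filter fun j => j = i ∨ G.Adj j i

open Classical in
/-- Out-neighborhood of `i`; by convention every node is an out-neighbor of itself. -/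
noncomputable def outNbrs (G : Digraph (Fin n)) (i : Fin n) : Finset (Fin n) :=
  Finset.univ.filter fun j => j = i ∨ G.Adj i j

/-- The in-degree (the node itself is counted). -/
noncomputable def inDeg (G : Digraph (Fin n)) (i : Fin n) : ℕ := (inNbrs G i).card

/-- The out-degree (the node itself is counted). -/
noncomputable def outDeg (G : Digraph (Fin n)) (i : Fin n) : ℕ := (outNbrs G i).card

/-- `B`-strong connectivity: `B` is positive and, for every `k`, the graph whose edge set is
the union of the edge sets at the times `kB, …, (k+1)B - 1` is strongly connected. -/
def BStronglyConnected (G : ℕ → Digraph (Fin n)) (B : ℕ) : Prop :=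
  0 < B ∧ ∀ k : ℕ, ∀ i j : Fin n,
    Relation.ReflTransGen
      (fun a b => ∃ t : ℕ, k * B ≤ t ∧ t < (k + 1) * B ∧ (G t).Adj a b) i j

/-- A directed graph is regular if all its in-degrees and out-degrees are equal. -/
def IsRegularDigraph (G : Digraph (Fin n)) : Prop :=
  ∃ r : ℕ, ∀ i : Fin n, outDeg G i = r ∧ inDeg G i = r

open Classical in
/-- The column-stochastic matrix of a graph: the `(i, j)` entry is `1 / d_j` if `j` is an
in-neighbor of `i`, and `0` otherwise. -/
noncomputable def pushMatrix (G : Digraph (Fin n)) : Matrix (Fin n) (Fin n) ℝ :=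
  Matrix.of fun i j => if j ∈ inNbrs G i then 1 / (outDeg G j : ℝ) else 0

/-- The second-largest singular value of a square real matrix (Mathlib lists the singular values
in decreasing order, with multiplicity, from index `0` on). -/
noncomputable def sigmaTwo (A : Matrix (Fin n) (Fin n) ℝ) : ℝ :=
  (Matrix.toEuclideanLin A).singularValues 1

end Graphs

/-! ### Convex functions on `ℝ^d` -/

section Convexity

variable {d : ℕ}

/-- `g` is a subgradient of `f` at `u`. -/
def IsSubgradient (f : EuclideanSpace ℝ (Fin d) → ℝ) (u g : EuclideanSpace ℝ (Fin d)) : Prop :=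
  ∀ v, f u + inner ℝ g (v - u) ≤ f v

/-- The largest Euclidean norm of a subgradient of `f` on the ball of radius `D` around `0`.
(For a finite convex `f` this set of norms is bounded and the supremum is attained.) -/
noncomputable def maxSubgradNorm (f : EuclideanSpace ℝ (Fin d) → ℝ) (D : ℝ) : ℝ :=
  sSup {r : ℝ | ∃ u g : EuclideanSpace ℝ (Fin d), ‖u‖ ≤ D ∧ IsSubgradient f u g ∧ r = ‖g‖}

/-- The `ℓ¹` norm on `ℝ^d`. -/
noncomputable def l1Norm (x : EuclideanSpace ℝ (Fin d)) : ℝ := ∑ k, |x k|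

end Convexity

/-! ### The stochastic subgradient-push method -/

section SubgradientPush

variable {n d : ℕ}

/-- The weights: `y_i(0) = 1`, `y_i(t+1) = ∑_{j ∈ N_i^in(t)} y_j(t) / d_j(t)`. -/
noncomputable def pushY (G : ℕ → Digraph (Fin n)) : ℕ → Fin n → ℝ
  | 0, _ => 1
  | t + 1, i => ∑ j ∈ inNbrs (G t) i, pushY G t j / (outDeg (G t) j : ℝ)

/-- One mixing step on vectors, `∑_{j ∈ N_i^in} x_j / d_j`. -/
noncomputable def pushMix (G : Digraph (Fin n)) (x : Fin n → EuclideanSpace ℝ (Fin d))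
    (i : Fin n) : EuclideanSpace ℝ (Fin d) :=
  ∑ j ∈ inNbrs G i, (outDeg G j : ℝ)⁻¹ • x j

/-- The variables `x_i(t)`, for the graph sequence `G`, stepsizes `α`, initial points `x0` and
an oracle `g`, where `g i t u` is the noisy subgradient that node `i` gets at time `t` at the
point `u`:
`w_i(t+1) = ∑_{j ∈ N_i^in(t)} x_j(t) / d_j(t)`, `z_i(t+1) = w_i(t+1) / y_i(t+1)`,
`x_i(t+1) = w_i(t+1) - α(t+1) g_i(z_i(t+1))`. -/
noncomputable def pushX (G : ℕ → Digraph (Fin n)) (α : ℕ → ℝ)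
    (g : Fin n → ℕ → EuclideanSpace ℝ (Fin d) → EuclideanSpace ℝ (Fin d))
    (x0 : Fin n → EuclideanSpace ℝ (Fin d)) : ℕ → Fin n → EuclideanSpace ℝ (Fin d)
  | 0, i => x0 i
  | t + 1, i =>
      pushMix (G t) (pushX G α g x0 t) i -
        α (t + 1) • g i (t + 1) ((pushY G (t + 1) i)⁻¹ • pushMix (G t) (pushX G α g x0 t) i)

/-- The variables `z_i(t)`; the method defines them for `t ≥ 1`, and the value at `t = 0`
is irrelevant. -/
noncomputable def pushZ (G : ℕ → Digraph (Fin n)) (α : ℕ → ℝ)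
    (g : Fin n → ℕ → EuclideanSpace ℝ (Fin d) → EuclideanSpace ℝ (Fin d))
    (x0 : Fin n → EuclideanSpace ℝ (Fin d)) : ℕ → Fin n → EuclideanSpace ℝ (Fin d)
  | 0, i => x0 i
  | t + 1, i => (pushY G (t + 1) i)⁻¹ • pushMix (G t) (pushX G α g x0 t) i

/-- The weighted average `(∑_{s=1}^t (s-1) z(s)) / (t(t-1)/2)`, for `t ≥ 2`. -/
noncomputable def weightedAvg (z : ℕ → EuclideanSpace ℝ (Fin d)) (t : ℕ) :
    EuclideanSpace ℝ (Fin d) :=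
  ((t : ℝ) * ((t : ℝ) - 1) / 2)⁻¹ • ∑ s ∈ Finset.Icc 1 t, ((s : ℝ) - 1) • z s

/-- The noisy oracle along the outcome `ω`: node `i` at time `t` draws the sample `ξ i t ω`
and returns, at the point `u`, the subgradient `sg i u` plus the noise `N i u (ξ i t ω)`. -/
def noisyOracle {Ω Ξ : Type*}
    (sg : Fin n → EuclideanSpace ℝ (Fin d) → EuclideanSpace ℝ (Fin d))
    (N : Fin n → EuclideanSpace ℝ (Fin d) → Ξ → EuclideanSpace ℝ (Fin d))
    (ξ : Fin n → ℕ → Ω → Ξ) (ω : Ω) :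
    Fin n → ℕ → EuclideanSpace ℝ (Fin d) → EuclideanSpace ℝ (Fin d) :=
  fun i t u => sg i u + N i u (ξ i t ω)

end SubgradientPush

/-!
The proof combines a contraction estimate for products of push matrices with the usual analysis of
the averaged subgradient method.

*Network.* The push matrices are column stochastic, so they preserve sums. After subtracting from a
vector its sum, distributed according to the weights `y(t)`, a vector of zero sum is left, and
`exists_contraction_scalars` shows that `k` factors shrink its entries to at most `2 λᵏ` times its
`ℓ¹` norm. For a general sequence this holds because the entries of a product over `nB` steps are
at least `n⁻ⁿᴮ` (`one_div_pow_le_pushProd`), which also bounds the weights from below. For regular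
sequences the matrices are doubly stochastic and `y = 1`; then either the second singular values
give the rate (`sum_sq_mulVec_le_sigmaTwo`), or the energy that is dissipated over a connectivity
window: with the entries sorted at the beginning of the window, each gap between consecutive
entries contributes when its cut is first crossed (`sum_sq_pushProd_window_le`). Hence all
`zᵢ(t + 1)` are close to the mean `x̄(t)` of the `xⱼ(t)` (`norm_pushZ_sub_nodeMean_le`).

*Optimization.* The mean moves by a subgradient step, and it is a convex combination of the
`zᵢ(t + 1)`, so that the subgradient bounds on the ball of radius `D` apply to it as well. One half
of the decrease of the objective is turned by strong convexity into a contraction of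
`‖x̄(t) - z*‖²`, the other half is kept (`norm_step_sub_sq_le`). With the weights `t (t + 1)` and
`p μ̄ ≥ 4` the squared distances telescope (`sum_mul_le_of_step`), and Jensen's inequality passes to
the weighted averages.

*Noise.* The noise of each node is orthogonal to the past and to the noise of the other nodes, so
only `∑ cⱼ²` remains of it in expectation (`integral_noiseTerm_le`). This use of independence across
the nodes gives the last term with the constant `p / τ`: the squares contribute
`2p / (nτ) ∑ cⱼ² ≤ p / τ ∑ cⱼ²`, and the corresponding term with `(∑ Lⱼ)²` fits into the room that
the constant `80` leaves (`weighted_error_le`).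
-/

/-! ### Products of push matrices -/

section PushMatrix

variable {n : ℕ}

lemma pushMatrix_apply (G : Digraph (Fin n)) (i j : Fin n) [Decidable (j ∈ inNbrs G i)] :
    pushMatrix G i j = if j ∈ inNbrs G i then 1 / (outDeg G j : ℝ) else 0 := by
  simp only [pushMatrix, Matrix.of_apply]
  congr

lemma mem_inNbrs {G : Digraph (Fin n)} {i j : Fin n} : j ∈ inNbrs G i ↔ j = i ∨ G.Adj j i := by
  simp [inNbrs]

lemma mem_outNbrs {G : Digraph (Fin n)} {i j : Fin n} : j ∈ outNbrs G i ↔ j = i ∨ G.Adj i j := by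
  simp [outNbrs]

lemma mem_inNbrs_iff_mem_outNbrs {G : Digraph (Fin n)} {i j : Fin n} :
    j ∈ inNbrs G i ↔ i ∈ outNbrs G j := by
  rw [mem_inNbrs, mem_outNbrs, eq_comm]

lemma outDeg_pos (G : Digraph (Fin n)) (j : Fin n) : 0 < outDeg G j :=
  Finset.card_pos.2 ⟨j, mem_outNbrs.2 (Or.inl rfl)⟩

lemma outDeg_le (G : Digraph (Fin n)) (j : Fin n) : outDeg G j ≤ n :=
  (Finset.card_le_univ (outNbrs G j)).trans_eq (Fintype.card_fin n)

lemma pushMatrix_nonneg (G : Digraph (Fin n)) (i j : Fin n) : 0 ≤ pushMatrix G i j := by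
  classical
  rw [pushMatrix_apply]; split_ifs <;> positivity

lemma one_div_le_pushMatrix {G : Digraph (Fin n)} {i j : Fin n} (h : j = i ∨ G.Adj j i) :
    1 / (n : ℝ) ≤ pushMatrix G i j := by
  classical
  rw [pushMatrix_apply, if_pos (mem_inNbrs.2 h)]
  have := outDeg_pos G j
  exact one_div_le_one_div_of_le (by exact_mod_cast this) (by exact_mod_cast outDeg_le G j)

lemma sum_col_pushMatrix (G : Digraph (Fin n)) (j : Fin n) : ∑ i, pushMatrix G i j = 1 := by
  classical
  have h : ∀ i, pushMatrix G i j = if i ∈ outNbrs G j then 1 / (outDeg G j : ℝ) else 0 := by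
    intro i
    rw [pushMatrix_apply]
    simp only [mem_inNbrs_iff_mem_outNbrs]
  have hd : (outDeg G j : ℝ) ≠ 0 := by exact_mod_cast (outDeg_pos G j).ne'
  simp only [h, Finset.sum_ite_mem, Finset.univ_inter, Finset.sum_const, nsmul_eq_mul]
  rw [← outDeg]
  field_simp

lemma pushMatrix_mulVec (G : Digraph (Fin n)) (v : Fin n → ℝ) (i : Fin n) :
    (pushMatrix G).mulVec v i = ∑ j ∈ inNbrs G i, v j / (outDeg G j : ℝ) := by
  classical
  simp only [Matrix.mulVec, dotProduct, pushMatrix_apply, ite_mul, zero_mul, Finset.sum_ite_mem,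
    Finset.univ_inter]
  exact Finset.sum_congr rfl fun j _ => by ring

/-- The product `A(s+k-1) ⋯ A(s)` of the push matrices over the `k` steps that start at time
`s`. -/
noncomputable def pushProd (G : ℕ → Digraph (Fin n)) (s : ℕ) : ℕ → Matrix (Fin n) (Fin n) ℝ
  | 0 => 1
  | k + 1 => pushMatrix (G (s + k)) * pushProd G s k

variable (G : ℕ → Digraph (Fin n))

lemma pushProd_add (s a b : ℕ) : pushProd G s (a + b) = pushProd G (s + a) b * pushProd G s a := by
  induction b with
  | zero => simp [pushProd]
  | succ b ih => rw [← add_assoc, pushProd, pushProd, ih, add_assoc, Matrix.mul_assoc]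

lemma pushProd_nonneg (s k : ℕ) (i j : Fin n) : 0 ≤ pushProd G s k i j := by
  induction k generalizing i with
  | zero => simp only [pushProd, Matrix.one_apply]; split_ifs <;> norm_num
  | succ k ih =>
    rw [pushProd, Matrix.mul_apply]
    exact Finset.sum_nonneg fun l _ => mul_nonneg (pushMatrix_nonneg _ _ _) (ih l)

lemma sum_pushMatrix_mulVec (H : Digraph (Fin n)) (v : Fin n → ℝ) :
    ∑ i, (pushMatrix H).mulVec v i = ∑ i, v i := by
  simp only [Matrix.mulVec, dotProduct]
  rw [Finset.sum_comm]
  simp [← Finset.sum_mul, sum_col_pushMatrix]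

lemma sum_pushProd_mulVec (s k : ℕ) (v : Fin n → ℝ) :
    ∑ i, (pushProd G s k).mulVec v i = ∑ i, v i := by
  induction k with
  | zero => simp [pushProd]
  | succ k ih => rw [pushProd, ← Matrix.mulVec_mulVec, sum_pushMatrix_mulVec, ih]

lemma sum_col_pushProd (s k : ℕ) (j : Fin n) : ∑ i, pushProd G s k i j = 1 := by
  simpa using sum_pushProd_mulVec G s k (Pi.single j 1)

lemma pushY_eq_pushProd_mulVec (t : ℕ) (i : Fin n) :
    pushY G t i = (pushProd G 0 t).mulVec (fun _ => 1) i := by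
  induction t generalizing i with
  | zero => simp [pushY, pushProd]
  | succ t ih =>
    rw [pushProd, ← Matrix.mulVec_mulVec, pushMatrix_mulVec, pushY]
    simp [ih]

lemma pushY_succ_eq_mulVec (t : ℕ) : pushY G (t + 1) = (pushMatrix (G t)).mulVec (pushY G t) := by
  ext i; rw [pushMatrix_mulVec, pushY]

lemma sum_pushY (t : ℕ) : ∑ i, pushY G t i = n := by
  simp only [pushY_eq_pushProd_mulVec, sum_pushProd_mulVec]
  simp

end PushMatrix

/-! ### Contraction for general graph sequences -/

section General

variable {n : ℕ} (G : ℕ → Digraph (Fin n))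

/-- The nodes that hold at least the share `n⁻ᵏ`, after `k` steps from time `s`, of a unit mass
put at the node `j`. -/
noncomputable def reached (s : ℕ) (j : Fin n) (k : ℕ) : Finset (Fin n) := by
  classical exact Finset.univ.filter fun i => (1 / (n : ℝ)) ^ k ≤ pushProd G s k i j

variable {G}

lemma mem_reached {s k : ℕ} {i j : Fin n} :
    i ∈ reached G s j k ↔ (1 / (n : ℝ)) ^ k ≤ pushProd G s k i j := by
  simp [reached]

lemma mem_reached_succ {s k : ℕ} {a b j : Fin n} (ha : a ∈ reached G s j k)
    (hab : a = b ∨ (G (s + k)).Adj a b) : b ∈ reached G s j (k + 1) := by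
  rw [mem_reached] at ha ⊢
  rw [pushProd, Matrix.mul_apply, pow_succ']
  refine le_trans ?_ (Finset.single_le_sum (f := fun l =>
    pushMatrix (G (s + k)) b l * pushProd G s k l j)
    (fun l _ => mul_nonneg (pushMatrix_nonneg _ _ _) (pushProd_nonneg _ _ _ _ _))
    (Finset.mem_univ a))
  exact mul_le_mul (one_div_le_pushMatrix hab) ha (by positivity) (pushMatrix_nonneg _ _ _)

lemma reached_mono (s : ℕ) (j : Fin n) : Monotone (reached G s j) :=
  monotone_nat_of_le_succ fun _ _ ha => mem_reached_succ ha (Or.inl rfl)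

lemma self_mem_reached (s k : ℕ) (j : Fin n) : j ∈ reached G s j k :=
  reached_mono s j (Nat.zero_le k) (by simp [mem_reached, pushProd])

lemma exists_edge_leaving {B : ℕ} (hG : BStronglyConnected G B) (κ : ℕ) (C : Set (Fin n))
    {a b : Fin n} (ha : a ∈ C) (hb : b ∉ C) :
    ∃ i ∈ C, ∃ j, j ∉ C ∧ ∃ t, κ * B ≤ t ∧ t < (κ + 1) * B ∧ (G t).Adj i j := by
  have h := hG.2 κ a b
  induction h with
  | refl => exact absurd ha hb
  | @tail c e _ hce ih =>
    by_cases hc : c ∈ C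
    · obtain ⟨t, h1, h2, h3⟩ := hce
      exact ⟨c, hc, e, hb, t, h1, h2, h3⟩
    · exact ih hc

/-- Over a full connectivity window the set of reached nodes gains a node, unless it is
everything already. -/
lemma card_reached_window {B : ℕ} (hG : BStronglyConnected G B) {s κ k : ℕ} (hs : s + k = κ * B)
    (j : Fin n) : min n ((reached G s j k).card + 1) ≤ (reached G s j (k + B)).card := by
  by_cases hU : reached G s j k = Finset.univ
  · have : reached G s j (k + B) = Finset.univ :=
      Finset.univ_subset_iff.1 (hU ▸ reached_mono s j (Nat.le_add_right k B))
    simp [this]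
  · obtain ⟨b, hb⟩ : ∃ b, b ∉ reached G s j k := by
      by_contra! h; exact hU (Finset.eq_univ_of_forall h)
    obtain ⟨i, hi, e, he, t, ht1, ht2, hadj⟩ :=
      exists_edge_leaving hG κ (reached G s j k : Set (Fin n)) (self_mem_reached s k j) hb
    obtain ⟨m, rfl⟩ := Nat.exists_eq_add_of_le (hs ▸ ht1)
    have hmB : m + 1 ≤ B := by rw [add_mul] at ht2; omega
    have h1 : i ∈ reached G s j (k + m) := reached_mono s j (Nat.le_add_right k m) hi
    have h2 : e ∈ reached G s j (k + B) :=
      reached_mono s j (show k + m + 1 ≤ k + B by omega)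
        (mem_reached_succ h1 (Or.inr (by rwa [← add_assoc])))
    refine (min_le_right _ _).trans (Finset.card_lt_card ?_)
    exact ⟨reached_mono s j (Nat.le_add_right k B), fun h => he (h h2)⟩

/-- All entries of a product over `nB` steps are at least `n^{-nB}`: the steps contain `n - 1`
full connectivity windows. -/
lemma one_div_pow_le_pushProd {B : ℕ} (hG : BStronglyConnected G B) (s : ℕ) (i j : Fin n) :
    1 / (n : ℝ) ^ (n * B) ≤ pushProd G s (n * B) i j := by
  have hB := hG.1
  have hn : 0 < n := i.pos
  obtain ⟨κ, a, ha, hκ⟩ : ∃ κ a, a ≤ B ∧ s + a = κ * B := by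
    refine ⟨s / B + 1, B - s % B, Nat.sub_le _ _, ?_⟩
    have h1 := Nat.mod_lt s hB
    have h2 := Nat.div_add_mod s B
    rw [add_mul, mul_comm]; omega
  have key : ∀ m, min n (m + 1) ≤ (reached G s j (a + m * B)).card := by
    intro m
    induction m with
    | zero =>
      have := Finset.card_pos.2 ⟨j, self_mem_reached (G := G) s (a + 0 * B) j⟩
      omega
    | succ m ih =>
      have := card_reached_window hG (s := s) (κ := κ + m) (k := a + m * B)
        (by rw [add_mul]; omega) j
      have e : a + (m + 1) * B = a + m * B + B := by ring
      rw [e]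
      omega
  have hle : a + (n - 1) * B ≤ n * B := by
    obtain ⟨m, rfl⟩ := Nat.exists_eq_succ_of_ne_zero hn.ne'
    simp only [Nat.succ_mul, Nat.succ_sub_one, Nat.succ_eq_add_one]
    omega
  have hU : reached G s j (n * B) = Finset.univ := by
    have h1 := key (n - 1)
    have h2 := Finset.card_le_card (reached_mono (G := G) s j hle)
    apply Finset.eq_univ_of_card
    have h3 := Finset.card_le_univ (reached G s j (n * B))
    simp only [Fintype.card_fin] at h3 ⊢
    omega
  have : i ∈ reached G s j (n * B) := hU ▸ Finset.mem_univ i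
  rw [mem_reached] at this
  simpa [div_pow] using this

/-- The push-sum weights stay away from `0`. -/
lemma one_div_pow_le_pushY {B : ℕ} (hG : BStronglyConnected G B) (t : ℕ) (i : Fin n) :
    1 / (n : ℝ) ^ (n * B) ≤ pushY G t i := by
  have hn : 0 < n := i.pos
  rw [pushY_eq_pushProd_mulVec]
  simp only [Matrix.mulVec, dotProduct, mul_one]
  rcases le_total t (n * B) with h | h
  · have h1 := mem_reached.1 (self_mem_reached (G := G) 0 t i)
    have h2 : pushProd G 0 t i i ≤ ∑ j, pushProd G 0 t i j :=
      Finset.single_le_sum (f := fun j => pushProd G 0 t i j)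
        (fun l _ => pushProd_nonneg _ _ _ _ _) (Finset.mem_univ i)
    refine le_trans ?_ (h1.trans h2)
    rw [div_pow, one_pow]
    have : (1 : ℝ) ≤ n := by exact_mod_cast hn
    exact one_div_le_one_div_of_le (by positivity) (pow_le_pow_right₀ this h)
  · obtain ⟨k, rfl⟩ := Nat.exists_eq_add_of_le' h
    have h1 : ∑ j, pushProd G 0 (k + n * B) i j
        = ∑ l, pushProd G (0 + k) (n * B) i l * ∑ j, pushProd G 0 k l j := by
      simp only [pushProd_add, Matrix.mul_apply, Finset.mul_sum]
      exact Finset.sum_comm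
    rw [h1]
    have h2 : ∑ l, (1 / (n : ℝ) ^ (n * B)) * ∑ j, pushProd G 0 k l j
        ≤ ∑ l, pushProd G (0 + k) (n * B) i l * ∑ j, pushProd G 0 k l j :=
      Finset.sum_le_sum fun l _ => mul_le_mul_of_nonneg_right (one_div_pow_le_pushProd hG _ _ _)
        (Finset.sum_nonneg fun j _ => pushProd_nonneg _ _ _ _ _)
    refine le_trans ?_ h2
    rw [← Finset.mul_sum, Finset.sum_comm (f := fun l j => pushProd G 0 k l j)]
    simp only [sum_col_pushProd, Finset.sum_const, Finset.card_univ, Fintype.card_fin,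
      nsmul_eq_mul, mul_one]
    have : (1 : ℝ) ≤ n := by exact_mod_cast hn
    exact le_mul_of_one_le_right (by positivity) this

lemma sum_abs_pushProd_mulVec_le (s k : ℕ) (v : Fin n → ℝ) :
    ∑ i, |(pushProd G s k).mulVec v i| ≤ ∑ j, |v j| := by
  calc ∑ i, |(pushProd G s k).mulVec v i|
      ≤ ∑ i, ∑ j, pushProd G s k i j * |v j| := by
        refine Finset.sum_le_sum fun i _ => ?_
        simp only [Matrix.mulVec, dotProduct]
        refine (Finset.abs_sum_le_sum_abs _ _).trans_eq ?_
        exact Finset.sum_congr rfl fun j _ => by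
          rw [abs_mul, abs_of_nonneg (pushProd_nonneg _ _ _ _ _)]
    _ = ∑ j, |v j| := by
        rw [Finset.sum_comm]
        simp [← Finset.sum_mul, sum_col_pushProd]

/-- A column-stochastic matrix with entries at least `η` contracts the `ℓ¹` norm of vectors of
zero sum by the factor `1 - nη ≤ 1 - η`. -/
lemma sum_abs_mulVec_le_of_le_entries {M : Matrix (Fin n) (Fin n) ℝ} {η : ℝ} (hη : 0 ≤ η)
    (hn : 0 < n) (hM : ∀ i j, η ≤ M i j) (hcol : ∀ j, ∑ i, M i j = 1) {v : Fin n → ℝ}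
    (hv : ∑ j, v j = 0) : ∑ i, |M.mulVec v i| ≤ (1 - η) * ∑ j, |v j| := by
  have h1 : ∀ i, M.mulVec v i = ∑ j, (M i j - η) * v j := by
    intro i
    simp only [Matrix.mulVec, dotProduct, sub_mul, Finset.sum_sub_distrib, ← Finset.mul_sum, hv]
    simp
  calc ∑ i, |M.mulVec v i| ≤ ∑ i, ∑ j, (M i j - η) * |v j| := by
        refine Finset.sum_le_sum fun i _ => ?_
        rw [h1]
        refine (Finset.abs_sum_le_sum_abs _ _).trans_eq ?_
        exact Finset.sum_congr rfl fun j _ => by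
          rw [abs_mul, abs_of_nonneg (sub_nonneg.2 (hM i j))]
    _ = (1 - n * η) * ∑ j, |v j| := by
        rw [Finset.sum_comm]
        simp [← Finset.sum_mul, hcol, ← Finset.mul_sum]
    _ ≤ (1 - η) * ∑ j, |v j| := by
        have : (1 : ℝ) ≤ n := by exact_mod_cast hn
        refine mul_le_mul_of_nonneg_right ?_ (Finset.sum_nonneg fun j _ => abs_nonneg _)
        nlinarith

/-- The rate for general sequences. The factor `2` makes up for the incomplete block of fewer than
`nB` steps, since `1 - n⁻ⁿᴮ ≥ 3/4`. -/
lemma abs_pushProd_mulVec_le_general {B : ℕ} (hn : 2 ≤ n) (hG : BStronglyConnected G B)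
    (s k : ℕ) {v : Fin n → ℝ} (hv : ∑ j, v j = 0) (i : Fin n) :
    |(pushProd G s k).mulVec v i|
      ≤ 2 * ((1 - 1 / (n : ℝ) ^ (n * B)) ^ (1 / ((n : ℝ) * (B : ℝ)))) ^ k * ∑ j, |v j| := by
  have hB := hG.1
  set η : ℝ := 1 / (n : ℝ) ^ (n * B) with hη
  have hnB : 2 ≤ n * B := hn.trans (Nat.le_mul_of_pos_right n hB)
  have hη0 : 0 ≤ η := by positivity
  have hη1 : η ≤ 1 / 4 := by
    have h2 : (2 : ℝ) ≤ n := by exact_mod_cast hn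
    have : (4 : ℝ) ≤ (n : ℝ) ^ (n * B) :=
      calc (4 : ℝ) = 2 ^ 2 := by norm_num
        _ ≤ (n : ℝ) ^ 2 := by gcongr
        _ ≤ (n : ℝ) ^ (n * B) := pow_le_pow_right₀ (by linarith) hnB
    exact one_div_le_one_div_of_le (by norm_num) this
  have hwin : ∀ m, ∑ i, |(pushProd G s (m * (n * B))).mulVec v i| ≤ (1 - η) ^ m * ∑ j, |v j| := by
    intro m
    induction m with
    | zero => simp [pushProd]
    | succ m ih =>
      rw [Nat.succ_mul, pushProd_add, ← Matrix.mulVec_mulVec, pow_succ']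
      refine (sum_abs_mulVec_le_of_le_entries hη0 (by omega)
        (fun i j => one_div_pow_le_pushProd hG _ i j) (sum_col_pushProd G _ _)
        (by rw [sum_pushProd_mulVec, hv])).trans ?_
      rw [mul_assoc]
      exact mul_le_mul_of_nonneg_left ih (by linarith)
  set a : ℝ := (1 - η) ^ (1 / ((n : ℝ) * (B : ℝ))) with ha
  have ha0 : 0 ≤ a := Real.rpow_nonneg (by linarith) _
  have ha1 : a ≤ 1 := Real.rpow_le_one (by linarith) (by linarith) (by positivity)
  have hpow : a ^ (n * B) = 1 - η := by
    have := Real.rpow_inv_natCast_pow (x := 1 - η) (by linarith) (n := n * B) (by omega)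
    rw [ha, one_div]
    exact_mod_cast this
  have hS : 0 ≤ ∑ j, |v j| := Finset.sum_nonneg fun j _ => abs_nonneg _
  calc |(pushProd G s k).mulVec v i|
      ≤ ∑ i, |(pushProd G s k).mulVec v i| :=
        Finset.single_le_sum (f := fun i => |(pushProd G s k).mulVec v i|)
          (fun i _ => abs_nonneg _) (Finset.mem_univ i)
    _ ≤ ∑ i, |(pushProd G s (k / (n * B) * (n * B))).mulVec v i| := by
        conv_lhs => rw [← Nat.div_add_mod' k (n * B)]
        simp only [pushProd_add G s (k / (n * B) * (n * B)), ← Matrix.mulVec_mulVec]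
        exact sum_abs_pushProd_mulVec_le _ _ _
    _ ≤ (1 - η) ^ (k / (n * B)) * ∑ j, |v j| := hwin _
    _ ≤ 2 * a ^ k * ∑ j, |v j| := by
        refine mul_le_mul_of_nonneg_right ?_ hS
        conv_rhs => rw [← Nat.div_add_mod' k (n * B)]
        rw [pow_add, mul_comm (k / (n * B)), pow_mul, hpow]
        have h1 : 1 - η ≤ a ^ (k % (n * B)) := by
          rw [← hpow]
          exact pow_le_pow_of_le_one ha0 ha1 (Nat.mod_lt _ (by omega)).le
        have h2 : 0 ≤ (1 - η) ^ (k / (n * B)) := pow_nonneg (by linarith) _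
        nlinarith

end General

/-! ### Contraction for regular graph sequences -/

section Regular

variable {n : ℕ}

lemma sum_row_pushMatrix {H : Digraph (Fin n)} (hH : IsRegularDigraph H) (i : Fin n) :
    ∑ j, pushMatrix H i j = 1 := by
  classical
  obtain ⟨r, hr⟩ := hH
  have hd : (inDeg H i : ℝ) ≠ 0 := by
    rw [(hr i).2, ← (hr i).1]; exact_mod_cast (outDeg_pos H i).ne'
  simp only [pushMatrix_apply, (hr _).1, Finset.sum_ite_mem, Finset.univ_inter, Finset.sum_const,
    nsmul_eq_mul]
  rw [← inDeg, ← (hr i).2]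
  field_simp

lemma pushY_eq_one_of_regular {G : ℕ → Digraph (Fin n)} (hG : ∀ t, IsRegularDigraph (G t))
    (t : ℕ) (i : Fin n) : pushY G t i = 1 := by
  induction t generalizing i with
  | zero => rfl
  | succ t ih =>
    rw [pushY_succ_eq_mulVec]
    simp [Matrix.mulVec, dotProduct, ih, sum_row_pushMatrix (hG t)]

/-- The energy that a doubly stochastic matrix dissipates, as a sum of squared differences. -/
lemma sum_sq_sub_sum_sq_mulVec {M : Matrix (Fin n) (Fin n) ℝ} (hcol : ∀ j, ∑ i, M i j = 1)
    (hrow : ∀ i, ∑ j, M i j = 1) (x : Fin n → ℝ) :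
    2 * (∑ j, x j ^ 2 - ∑ k, M.mulVec x k ^ 2)
      = ∑ k, ∑ i, ∑ j, M k i * M k j * (x i - x j) ^ 2 := by
  have h1 : ∀ k, ∑ i, ∑ j, M k i * M k j * (x i - x j) ^ 2
      = 2 * ∑ i, M k i * x i ^ 2 - 2 * M.mulVec x k ^ 2 := by
    intro k
    have e : ∀ i j, M k i * M k j * (x i - x j) ^ 2
        = (M k i * x i ^ 2) * M k j + M k i * (M k j * x j ^ 2)
          - 2 * ((M k i * x i) * (M k j * x j)) := fun i j => by ring
    simp only [e, Finset.sum_sub_distrib, Finset.sum_add_distrib, ← Finset.mul_sum,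
      ← Finset.sum_mul, hrow, Matrix.mulVec, dotProduct]
    ring
  simp only [h1, Finset.sum_sub_distrib, ← Finset.mul_sum]
  rw [Finset.sum_comm]
  simp only [← Finset.sum_mul, hcol]
  ring_nf

/-- The graph `H` has an edge, in either direction, between the nodes of rank at most `d` and
those of larger rank. -/
def CrossesCut (H : Digraph (Fin n)) (ρ : Fin n → ℕ) (d : ℕ) : Prop :=
  ∃ i j, H.Adj i j ∧ (ρ i ≤ d ∧ d < ρ j ∨ ρ j ≤ d ∧ d < ρ i)

/-- The squared gaps over a set of cuts between two nodes add up to at most the squared difference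
of the values at the nodes. -/
lemma sum_gap_sq_le_sq {y : ℕ → ℝ} (hy : Monotone y) {S : Finset ℕ} {a b : ℕ} {u v : ℝ}
    (hu : ∀ d ∈ S, a ≤ d → u ≤ y d) (hv : ∀ d ∈ S, d < b → y (d + 1) ≤ v) :
    ∑ d ∈ S with a ≤ d ∧ d < b, (y (d + 1) - y d) ^ 2 ≤ (v - u) ^ 2 := by
  set T := S.filter fun d => a ≤ d ∧ d < b with hT
  rcases T.eq_empty_or_nonempty with h | h
  · rw [h]; simpa using sq_nonneg (v - u)
  have hgap : ∀ d, 0 ≤ y (d + 1) - y d := fun d => sub_nonneg.2 (hy (Nat.le_succ d))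
  have hmin := Finset.mem_filter.1 (T.min'_mem h)
  have hmax := Finset.mem_filter.1 (T.max'_mem h)
  have h1 : ∑ d ∈ T, (y (d + 1) - y d) ≤ y (T.max' h + 1) - y (T.min' h) := by
    have hle : T.min' h ≤ T.max' h + 1 := (T.min'_le_max' h).trans (Nat.le_succ _)
    rw [← Finset.sum_Ico_sub y hle]
    refine Finset.sum_le_sum_of_subset_of_nonneg (fun d hd => ?_) fun d _ _ => hgap d
    exact Finset.mem_Ico.2 ⟨T.min'_le d hd, Nat.lt_succ_of_le (T.le_max' d hd)⟩
  have h2 : ∑ d ∈ T, (y (d + 1) - y d) ≤ v - u := by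
    have := hu _ hmin.1 hmin.2.1
    have := hv _ hmax.1 hmax.2.2
    linarith
  have h0 : 0 ≤ ∑ d ∈ T, (y (d + 1) - y d) := Finset.sum_nonneg fun d _ => hgap d
  calc ∑ d ∈ T, (y (d + 1) - y d) ^ 2 ≤ (∑ d ∈ T, (y (d + 1) - y d)) ^ 2 :=
        Finset.sum_sq_le_sq_sum_of_nonneg fun d _ => hgap d
    _ ≤ (v - u) ^ 2 := pow_le_pow_left₀ h0 h2 2

/-- The head of an edge across a cut gives weight at least `1/n` to both sides. -/
lemma one_div_le_sum_low_mul_sum_high {H : Digraph (Fin n)} (hn : 2 ≤ n)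
    (hH : IsRegularDigraph H) {ρ : Fin n → ℕ} {d : ℕ} (hd : CrossesCut H ρ d) :
    1 / (2 * (n : ℝ)) ≤ ∑ k, (∑ i with ρ i ≤ d, pushMatrix H k i) *
      ∑ j with d < ρ j, pushMatrix H k j := by
  obtain ⟨i, k, hadj, hik⟩ := hd
  have hnn : ∀ (k : Fin n) (T : Finset (Fin n)), 0 ≤ ∑ i ∈ T, pushMatrix H k i :=
    fun k T => Finset.sum_nonneg fun i _ => pushMatrix_nonneg _ _ _
  refine le_trans ?_ (Finset.single_le_sum (f := fun k => (∑ i with ρ i ≤ d, pushMatrix H k i) *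
      ∑ j with d < ρ j, pushMatrix H k j) (fun k _ => mul_nonneg (hnn _ _) (hnn _ _))
      (Finset.mem_univ k))
  have hsum : (∑ i with ρ i ≤ d, pushMatrix H k i) + ∑ j with d < ρ j, pushMatrix H k j = 1 := by
    rw [← sum_row_pushMatrix hH k, 
      ← Finset.sum_filter_add_sum_filter_not Finset.univ (fun i => ρ i ≤ d)
        (fun i => pushMatrix H k i)]
    simp only [not_le]
  have hsingle : ∀ (T : Finset (Fin n)) (l : Fin n), l ∈ T → (l = k ∨ H.Adj l k) →
      1 / (n : ℝ) ≤ ∑ i ∈ T, pushMatrix H k i := fun T l hl h =>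
    (one_div_le_pushMatrix h).trans (Finset.single_le_sum (f := fun i => pushMatrix H k i)
      (fun i _ => pushMatrix_nonneg _ _ _) hl)
  have hp : 1 / (n : ℝ) ≤ ∑ i with ρ i ≤ d, pushMatrix H k i := by
    rcases hik with h | h
    · exact hsingle _ i (by simpa using h.1) (Or.inr hadj)
    · exact hsingle _ k (by simpa using h.1) (Or.inl rfl)
  have hq : 1 / (n : ℝ) ≤ ∑ j with d < ρ j, pushMatrix H k j := by
    rcases hik with h | h
    · exact hsingle _ k (by simpa using h.2) (Or.inl rfl)
    · exact hsingle _ i (by simpa using h.2) (Or.inr hadj)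
  have hn' : 1 / (n : ℝ) ≤ 1 / 2 :=
    one_div_le_one_div_of_le (by norm_num) (by exact_mod_cast hn)
  have hn0 : 0 ≤ 1 / (n : ℝ) := by positivity
  have e : 1 / (2 * (n : ℝ)) = 1 / (n : ℝ) * (1 / 2) := by rw [one_div_mul_one_div, mul_comm]
  rw [e]
  nlinarith [mul_nonneg (sub_nonneg.2 hp) (sub_nonneg.2 hq)]

/-- If the values on the two sides of every cut in `S` are separated by the gap
`y (d + 1) - y d`, and the graph crosses every such cut, then one mixing step dissipates at least
the energy `(2n)⁻¹ ∑ (y (d + 1) - y d)²`. -/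
lemma sum_gap_sq_le_dissipation {H : Digraph (Fin n)} (hn : 2 ≤ n) (hH : IsRegularDigraph H)
    {ρ : Fin n → ℕ} {y : ℕ → ℝ} (hy : Monotone y) {S : Finset ℕ} {x : Fin n → ℝ}
    (hlow : ∀ d ∈ S, ∀ i, ρ i ≤ d → x i ≤ y d)
    (hhigh : ∀ d ∈ S, ∀ i, d < ρ i → y (d + 1) ≤ x i)
    (hS : ∀ d ∈ S, CrossesCut H ρ d) :
    1 / (2 * (n : ℝ)) * ∑ d ∈ S, (y (d + 1) - y d) ^ 2
      ≤ ∑ j, x j ^ 2 - ∑ k, (pushMatrix H).mulVec x k ^ 2 := by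
  set M := pushMatrix H
  set g : ℕ → ℝ := fun d => (y (d + 1) - y d) ^ 2 with hg
  have hg0 : ∀ d, 0 ≤ g d := fun d => sq_nonneg _
  set σ : Fin n → Fin n → ℝ := fun i j => ∑ d ∈ S with ρ i ≤ d ∧ d < ρ j, g d with hσ
  have hle : ∀ i j, σ i j ≤ (x i - x j) ^ 2 := by
    intro i j
    rw [← neg_sub, neg_sq]
    exact sum_gap_sq_le_sq hy (fun d hd h => hlow d hd i h) (fun d hd h => hhigh d hd j h)
  have hzero : ∀ i j, ρ j ≤ ρ i → σ i j = 0 := by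
    intro i j hij
    simp only [hσ]
    rw [Finset.filter_false_of_mem, Finset.sum_empty]
    intro d _ h; omega
  have hpair : ∀ i j, σ i j + σ j i ≤ (x i - x j) ^ 2 := by
    intro i j
    rcases le_total (ρ j) (ρ i) with h | h
    · rw [hzero i j h, zero_add, ← neg_sub, neg_sq]; exact hle j i
    · rw [hzero j i h, add_zero]; exact hle i j
  have hMnn : ∀ k i, 0 ≤ M k i := pushMatrix_nonneg H
  have h1 : 2 * ∑ k, ∑ i, ∑ j, M k i * M k j * σ i j
      ≤ ∑ k, ∑ i, ∑ j, M k i * M k j * (x i - x j) ^ 2 := by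
    rw [Finset.mul_sum]
    refine Finset.sum_le_sum fun k _ => ?_
    have hsw : ∑ i, ∑ j, M k i * M k j * σ i j = ∑ i, ∑ j, M k i * M k j * σ j i := by
      rw [Finset.sum_comm]
      exact Finset.sum_congr rfl fun i _ => Finset.sum_congr rfl fun j _ => by ring
    rw [two_mul]
    nth_rewrite 2 [hsw]
    simp only [← Finset.sum_add_distrib, ← mul_add]
    exact Finset.sum_le_sum fun i _ => Finset.sum_le_sum fun j _ =>
      mul_le_mul_of_nonneg_left (hpair i j) (mul_nonneg (hMnn _ _) (hMnn _ _))
  have h2 : ∀ k, ∑ i, ∑ j, M k i * M k j * σ i j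
      = ∑ d ∈ S, g d * ((∑ i with ρ i ≤ d, M k i) * ∑ j with d < ρ j, M k j) := by
    intro k
    have e1 : ∀ i j, M k i * M k j * σ i j
        = ∑ d ∈ S, g d * ((if ρ i ≤ d then M k i else 0) * if d < ρ j then M k j else 0) := by
      intro i j
      simp only [hσ, Finset.sum_filter, Finset.mul_sum]
      refine Finset.sum_congr rfl fun d _ => ?_
      by_cases ha : ρ i ≤ d <;> by_cases hb : d < ρ j <;> simp [ha, hb]; ring
    simp only [e1, Finset.sum_filter, Finset.sum_mul_sum]
    simp only [Finset.mul_sum]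
    exact (Finset.sum_congr rfl fun i _ => Finset.sum_comm).trans Finset.sum_comm
  have h3 : 1 / (2 * (n : ℝ)) * ∑ d ∈ S, g d
      ≤ ∑ k, ∑ d ∈ S, g d * ((∑ i with ρ i ≤ d, M k i) * ∑ j with d < ρ j, M k j) := by
    rw [Finset.sum_comm, Finset.mul_sum]
    refine Finset.sum_le_sum fun d hd => ?_
    rw [← Finset.mul_sum, mul_comm]
    exact mul_le_mul_of_nonneg_left (one_div_le_sum_low_mul_sum_high hn hH (hS d hd)) (hg0 d)
  have h4 := sum_sq_sub_sum_sq_mulVec (sum_col_pushMatrix H) (sum_row_pushMatrix hH) x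
  simp only [h2] at h1
  linarith

lemma pushMatrix_mulVec_le {H : Digraph (Fin n)} (hH : IsRegularDigraph H) {x : Fin n → ℝ}
    {c : ℝ} {i : Fin n} (h : ∀ j, j = i ∨ H.Adj j i → x j ≤ c) :
    (pushMatrix H).mulVec x i ≤ c := by
  classical
  rw [← one_mul c, ← sum_row_pushMatrix hH i, Finset.sum_mul]
  simp only [Matrix.mulVec, dotProduct]
  refine Finset.sum_le_sum fun j _ => ?_
  by_cases hj : j = i ∨ H.Adj j i
  · exact mul_le_mul_of_nonneg_left (h j hj) (pushMatrix_nonneg _ _ _)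
  · rw [pushMatrix_apply, if_neg (mt mem_inNbrs.1 hj), zero_mul, zero_mul]

lemma le_pushMatrix_mulVec {H : Digraph (Fin n)} (hH : IsRegularDigraph H) {x : Fin n → ℝ}
    {c : ℝ} {i : Fin n} (h : ∀ j, j = i ∨ H.Adj j i → c ≤ x j) :
    c ≤ (pushMatrix H).mulVec x i := by
  have := pushMatrix_mulVec_le hH (x := -x) (c := -c) (i := i)
    fun j hj => by simpa using h j hj
  rw [Matrix.mulVec_neg, Pi.neg_apply] at this
  linarith

/-- The squared norm of a vector of zero sum is at most `n²` times the sum of the squared gaps of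
its sorted entries. -/
lemma sum_sq_le_sq_mul_sum_gap_sq {x : Fin n → ℝ} (hx : ∑ i, x i = 0) {y : ℕ → ℝ}
    (hxy : ∀ i, y 0 ≤ x i ∧ x i ≤ y (n - 1)) :
    ∑ i, x i ^ 2 ≤ (n : ℝ) ^ 2 * ∑ d ∈ Finset.range (n - 1), (y (d + 1) - y d) ^ 2 := by
  rcases Nat.eq_zero_or_pos n with h0 | h0
  · subst h0; simp
  have : Nonempty (Fin n) := ⟨⟨0, h0⟩⟩
  have hne : (Finset.univ : Finset (Fin n)).Nonempty := Finset.univ_nonempty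
  obtain ⟨a, -, ha⟩ := Finset.exists_le_of_sum_le (s := Finset.univ) (f := x) (g := fun _ => 0)
    hne (by simp [hx])
  obtain ⟨b, -, hb⟩ := Finset.exists_le_of_sum_le (s := Finset.univ) (f := fun _ => 0) (g := x)
    hne (by simp [hx])
  have hsq : ∀ i, x i ^ 2 ≤ (y (n - 1) - y 0) ^ 2 := by
    intro i
    apply sq_le_sq'
    · linarith [(hxy i).1, (hxy b).2]
    · linarith [(hxy i).2, (hxy a).1]
  have hcs : (y (n - 1) - y 0) ^ 2
      ≤ n * ∑ d ∈ Finset.range (n - 1), (y (d + 1) - y d) ^ 2 := by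
    rw [← Finset.sum_range_sub]
    refine sq_sum_le_card_mul_sum_sq.trans ?_
    rw [Finset.card_range]
    refine mul_le_mul_of_nonneg_right ?_ (Finset.sum_nonneg fun d _ => sq_nonneg _)
    exact_mod_cast Nat.sub_le n 1
  calc ∑ i, x i ^ 2 ≤ ∑ _i : Fin n, (y (n - 1) - y 0) ^ 2 := Finset.sum_le_sum fun i _ => hsq i
    _ = n * (y (n - 1) - y 0) ^ 2 := by simp
    _ ≤ n * (n * ∑ d ∈ Finset.range (n - 1), (y (d + 1) - y d) ^ 2) := by gcongr
    _ = _ := by ring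

/-- The entries of `x`, listed in increasing order as `y 0, …, y (n - 1)`, with `ρ i` a position of
`x i` in the list; `y` is constant from `n - 1` on. -/
lemma exists_sorted (hn : 0 < n) (x : Fin n → ℝ) :
    ∃ (ρ : Fin n → ℕ) (y : ℕ → ℝ), Monotone y ∧ (∀ i, x i = y (ρ i)) ∧ (∀ i, ρ i ≤ n - 1) ∧
      ∀ d ≤ n - 1, ∃ i, ρ i = d := by
  refine ⟨fun i => ((Tuple.sort x).symm i : ℕ),
    fun d => x (Tuple.sort x ⟨min d (n - 1), by omega⟩), ?_, ?_, ?_, ?_⟩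
  · intro a b hab
    exact Tuple.monotone_sort x (Fin.mk_le_mk.2 (min_le_min_right _ hab))
  · intro i
    have : (⟨min ((Tuple.sort x).symm i : ℕ) (n - 1), by omega⟩ : Fin n)
        = (Tuple.sort x).symm i := by
      ext; simp only; omega
    simp only [this, Equiv.apply_symm_apply]
  · intro i
    have := ((Tuple.sort x).symm i).isLt
    simp only; omega
  · intro d hd
    exact ⟨Tuple.sort x ⟨d, by omega⟩, by simp⟩

/-- Over a full connectivity window of regular graphs, the squared norm of a vector of zero sum
drops by the factor `1 - 1/(2n³)`: with the entries sorted at the beginning of the window, every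
gap between consecutive entries contributes when its cut is crossed for the first time. -/
lemma sum_sq_pushProd_window_le {G : ℕ → Digraph (Fin n)} {B : ℕ} (hn : 2 ≤ n)
    (hG : BStronglyConnected G B) (hreg : ∀ t, IsRegularDigraph (G t)) (κ : ℕ) {x : Fin n → ℝ}
    (hx : ∑ i, x i = 0) :
    ∑ i, (pushProd G (κ * B) B).mulVec x i ^ 2
      ≤ (1 - 1 / (2 * (n : ℝ) ^ 3)) * ∑ i, x i ^ 2 := by
  classical
  obtain ⟨ρ, y, hy, hxy, hρ, hsurj⟩ := exists_sorted (by omega : 0 < n) x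
  set X : ℕ → Fin n → ℝ := fun m => (pushProd G (κ * B) m).mulVec x with hX
  have hX0 : X 0 = x := by simp [hX, pushProd]
  have hXs : ∀ m, X (m + 1) = (pushMatrix (G (κ * B + m))).mulVec (X m) := by
    intro m; simp only [hX]; rw [pushProd, Matrix.mulVec_mulVec]
  -- the cuts that no edge has crossed during the first `m` steps of the window
  set S : ℕ → Finset ℕ := fun m => (Finset.range (n - 1)).filter
    fun d => ∀ l < m, ¬ CrossesCut (G (κ * B + l)) ρ d with hS
  have hbd : ∀ m, ∀ d ∈ S m,
      (∀ i, ρ i ≤ d → X m i ≤ y d) ∧ ∀ i, d < ρ i → y (d + 1) ≤ X m i := by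
    intro m
    induction m with
    | zero =>
      intro d _
      rw [hX0]
      exact ⟨fun i hi => (hxy i).trans_le (hy hi), fun i hi => (hy hi).trans_eq (hxy i).symm⟩
    | succ m ih =>
      intro d hd
      obtain ⟨hd1, hd2⟩ := Finset.mem_filter.1 hd
      have hnc := hd2 m (Nat.lt_succ_self m)
      obtain ⟨ih1, ih2⟩ := ih d (Finset.mem_filter.2 ⟨hd1, fun l hl => hd2 l (by omega)⟩)
      rw [hXs]
      constructor
      · intro i hi
        refine pushMatrix_mulVec_le (hreg _) fun j hj => ih1 j ?_
        rcases hj with rfl | hj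
        · exact hi
        · by_contra! h; exact hnc ⟨j, i, hj, Or.inr ⟨hi, h⟩⟩
      · intro i hi
        refine le_pushMatrix_mulVec (hreg _) fun j hj => ih2 j ?_
        rcases hj with rfl | hj
        · exact hi
        · by_contra! h; exact hnc ⟨j, i, hj, Or.inl ⟨h, hi⟩⟩
  set g : ℕ → ℝ := fun d => (y (d + 1) - y d) ^ 2 with hg
  have hmono : ∀ m, S (m + 1) ⊆ S m := by
    intro m d hd
    obtain ⟨hd1, hd2⟩ := Finset.mem_filter.1 hd
    exact Finset.mem_filter.2 ⟨hd1, fun l hl => hd2 l (by omega)⟩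
  have hdrop : ∀ m, 1 / (2 * (n : ℝ)) * (∑ d ∈ Finset.range (n - 1), g d - ∑ d ∈ S m, g d)
      ≤ ∑ i, x i ^ 2 - ∑ i, X m i ^ 2 := by
    intro m
    induction m with
    | zero => simp [hS, hX0]
    | succ m ih =>
      have h := sum_gap_sq_le_dissipation hn (hreg (κ * B + m)) hy (S := S m \ S (m + 1))
        (x := X m) (fun d hd => (hbd m d (Finset.sdiff_subset hd)).1)
        (fun d hd => (hbd m d (Finset.sdiff_subset hd)).2) (fun d hd => by
          obtain ⟨h1, h2⟩ := Finset.mem_sdiff.1 hd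
          obtain ⟨h3, h4⟩ := Finset.mem_filter.1 h1
          by_contra hc
          refine h2 (Finset.mem_filter.2 ⟨h3, fun l hl => ?_⟩)
          rcases Nat.lt_succ_iff_lt_or_eq.1 hl with h | rfl
          · exact h4 l h
          · exact hc)
      rw [← hXs] at h
      have hsd := Finset.sum_sdiff (f := g) (hmono m)
      rw [← hsd] at ih
      linarith
  have hSB : S B = ∅ := by
    refine Finset.filter_false_of_mem fun d hd hnc => ?_
    have hd' := Finset.mem_range.1 hd
    obtain ⟨a, ha⟩ := hsurj d (by omega)
    obtain ⟨b, hb⟩ := hsurj (d + 1) (by omega)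
    obtain ⟨i, hi, j, hj, t, ht1, ht2, hadj⟩ := exists_edge_leaving hG κ {i | ρ i ≤ d}
      (a := a) (b := b) ha.le (by simp [hb])
    obtain ⟨l, rfl⟩ := Nat.exists_eq_add_of_le ht1
    exact hnc l (by rw [add_mul] at ht2; omega) ⟨i, j, hadj, Or.inl ⟨hi, not_le.1 hj⟩⟩
  have h1 := hdrop B
  rw [hSB, Finset.sum_empty, sub_zero] at h1
  have h2 := sum_sq_le_sq_mul_sum_gap_sq (y := y) hx fun i =>
    ⟨(hy (Nat.zero_le _)).trans_eq (hxy i).symm, (hxy i).trans_le (hy (hρ i))⟩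
  have hn0 : (0 : ℝ) < n := by exact_mod_cast (by omega : 0 < n)
  have h3 : 1 / (2 * (n : ℝ) ^ 3) * ∑ i, x i ^ 2
      ≤ 1 / (2 * (n : ℝ)) * ∑ d ∈ Finset.range (n - 1), g d := by
    calc _ ≤ 1 / (2 * (n : ℝ) ^ 3) * ((n : ℝ) ^ 2 * ∑ d ∈ Finset.range (n - 1), g d) := by gcongr
      _ = _ := by field_simp
  change ∑ i, X B i ^ 2 ≤ _
  linarith

lemma sum_sq_pushProd_mulVec_le {G : ℕ → Digraph (Fin n)} (hreg : ∀ t, IsRegularDigraph (G t))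
    (s k : ℕ) (x : Fin n → ℝ) : ∑ i, (pushProd G s k).mulVec x i ^ 2 ≤ ∑ i, x i ^ 2 := by
  induction k with
  | zero => simp [pushProd]
  | succ k ih =>
    rw [pushProd, ← Matrix.mulVec_mulVec]
    have h := sum_sq_sub_sum_sq_mulVec (sum_col_pushMatrix (G (s + k)))
      (sum_row_pushMatrix (hreg (s + k))) ((pushProd G s k).mulVec x)
    have : 0 ≤ ∑ l, ∑ i, ∑ j, pushMatrix (G (s + k)) l i * pushMatrix (G (s + k)) l j *
        ((pushProd G s k).mulVec x i - (pushProd G s k).mulVec x j) ^ 2 :=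
      Finset.sum_nonneg fun l _ => Finset.sum_nonneg fun i _ => Finset.sum_nonneg fun j _ =>
        mul_nonneg (mul_nonneg (pushMatrix_nonneg _ _ _) (pushMatrix_nonneg _ _ _)) (sq_nonneg _)
    linarith

/-- A bound on the `ℓ²` norm of a vector bounds each entry, with the `ℓ¹` norm of the input. -/
lemma abs_le_of_sum_sq_le {u v : Fin n → ℝ} {c : ℝ} (hc : 0 ≤ c)
    (h : ∑ i, u i ^ 2 ≤ c ^ 2 * ∑ i, v i ^ 2) (i : Fin n) : |u i| ≤ c * ∑ j, |v j| := by
  have hS : 0 ≤ ∑ j, |v j| := Finset.sum_nonneg fun j _ => abs_nonneg _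
  refine abs_le_of_sq_le_sq ?_ (mul_nonneg hc hS)
  have h1 : u i ^ 2 ≤ ∑ i, u i ^ 2 :=
    Finset.single_le_sum (f := fun i => u i ^ 2) (fun i _ => sq_nonneg _) (Finset.mem_univ i)
  have h2 : ∑ i, v i ^ 2 ≤ (∑ j, |v j|) ^ 2 := by
    simpa using Finset.sum_sq_le_sq_sum_of_nonneg (s := Finset.univ) (f := fun j => |v j|)
      fun j _ => abs_nonneg _
  rw [mul_pow]
  exact (h1.trans h).trans (mul_le_mul_of_nonneg_left h2 (sq_nonneg c))

/-- The rate for regular sequences. The factor `2` makes up for the incomplete windows at both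
ends, since `(1 - 1/(4n³))² ≥ (31/32)²`. -/
lemma abs_pushProd_mulVec_le_regular {G : ℕ → Digraph (Fin n)} {B : ℕ} (hn : 2 ≤ n)
    (hG : BStronglyConnected G B) (hreg : ∀ t, IsRegularDigraph (G t))
    (s k : ℕ) {v : Fin n → ℝ} (hv : ∑ j, v j = 0) (i : Fin n) :
    |(pushProd G s k).mulVec v i|
      ≤ 2 * ((1 - 1 / (4 * (n : ℝ) ^ 3)) ^ (1 / (B : ℝ))) ^ k * ∑ j, |v j| := by
  have hB := hG.1
  set q : ℝ := 1 - 1 / (4 * (n : ℝ) ^ 3) with hq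
  have hn8 : 1 / (n : ℝ) ^ 3 ≤ 1 / 8 := by
    refine one_div_le_one_div_of_le (by norm_num) ?_
    have h2 : (2 : ℝ) ≤ n := by exact_mod_cast hn
    calc (8 : ℝ) = 2 ^ 3 := by norm_num
      _ ≤ (n : ℝ) ^ 3 := by gcongr
  have hn0 : 0 ≤ 1 / (n : ℝ) ^ 3 := by positivity
  have hqe : q = 1 - 1 / 4 * (1 / (n : ℝ) ^ 3) := by rw [hq, one_div_mul_one_div]
  have hq1 : q ≤ 1 := by rw [hqe]; linarith
  have hq2 : 31 / 32 ≤ q := by rw [hqe]; linarith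
  have hqq : 1 - 1 / (2 * (n : ℝ) ^ 3) ≤ q ^ 2 := by
    have : 1 / (2 * (n : ℝ) ^ 3) = 1 / 2 * (1 / (n : ℝ) ^ 3) := by rw [one_div_mul_one_div]
    rw [this, hqe]; nlinarith
  set b : ℝ := q ^ (1 / (B : ℝ)) with hb
  have hb0 : 0 ≤ b := Real.rpow_nonneg (by linarith) _
  have hb1 : b ≤ 1 := Real.rpow_le_one (by linarith) (by linarith) (by positivity)
  have hpow : b ^ B = q := by
    rw [hb, one_div]; exact Real.rpow_inv_natCast_pow (by linarith) (by omega)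
  have hwin : ∀ κ m, ∀ x : Fin n → ℝ, ∑ i, x i = 0 →
      ∑ i, (pushProd G (κ * B) (m * B)).mulVec x i ^ 2 ≤ (q ^ m) ^ 2 * ∑ i, x i ^ 2 := by
    intro κ m x hx
    induction m with
    | zero => simp [pushProd]
    | succ m ih =>
      rw [Nat.succ_mul, pushProd_add, ← Matrix.mulVec_mulVec, ← add_mul]
      refine (sum_sq_pushProd_window_le hn hG hreg _ (by rw [sum_pushProd_mulVec, hx])).trans ?_
      rw [pow_succ q m, mul_pow, mul_comm ((q ^ m) ^ 2), mul_assoc]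
      exact mul_le_mul hqq ih (Finset.sum_nonneg fun i _ => sq_nonneg _) (sq_nonneg q)
  -- `k` steps contain `m` full windows, where `k ≤ (m + 2) B`
  obtain ⟨m, hm, hm2⟩ : ∃ m, k ≤ (m + 2) * B ∧
      ∑ i, (pushProd G s k).mulVec v i ^ 2 ≤ (q ^ m) ^ 2 * ∑ i, v i ^ 2 := by
    have h1 := Nat.mod_lt s hB
    have h2 := Nat.div_add_mod' s B
    set a := B - s % B with ha
    have hs : s + a = (s / B + 1) * B := by rw [add_mul]; omega
    rcases lt_or_ge k a with hk | hk
    · refine ⟨0, by omega, ?_⟩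
      simpa using sum_sq_pushProd_mulVec_le hreg s k v
    · have h3 := Nat.mod_lt (k - a) hB
      have h4 := Nat.div_add_mod' (k - a) B
      refine ⟨(k - a) / B, by rw [add_mul]; omega, ?_⟩
      have hk' : k = a + ((k - a) / B * B + (k - a) % B) := by omega
      have e : pushProd G s k = pushProd G (s + a + (k - a) / B * B) ((k - a) % B) *
          (pushProd G ((s / B + 1) * B) ((k - a) / B * B) * pushProd G s a) := by
        conv_lhs => rw [hk']
        rw [pushProd_add, pushProd_add, hs, Matrix.mul_assoc]
      rw [e, ← Matrix.mulVec_mulVec, ← Matrix.mulVec_mulVec]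
      refine (sum_sq_pushProd_mulVec_le hreg _ _ _).trans ?_
      refine (hwin _ _ _ (by rw [sum_pushProd_mulVec, hv])).trans ?_
      exact mul_le_mul_of_nonneg_left (sum_sq_pushProd_mulVec_le hreg _ _ _) (sq_nonneg _)
  have hqm : 0 ≤ q ^ m := pow_nonneg (by linarith) m
  refine (abs_le_of_sum_sq_le hqm hm2 i).trans ?_
  refine mul_le_mul_of_nonneg_right ?_ (Finset.sum_nonneg fun j _ => abs_nonneg _)
  have h5 : q ^ (m + 2) ≤ b ^ k := by
    rw [← hpow, ← pow_mul, mul_comm B]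
    exact pow_le_pow_of_le_one hb0 hb1 hm
  have h6 : q ^ m ≤ 2 * q ^ (m + 2) := by
    rw [pow_add]
    have : 1 / 2 ≤ q ^ 2 := by nlinarith
    nlinarith
  linarith

end Regular

/-! ### The second singular value as a contraction factor -/

section SingularValue

variable {n : ℕ}

lemma sum_sq_mulVec_le {H : Digraph (Fin n)} (hH : IsRegularDigraph H) (x : Fin n → ℝ) :
    ∑ i, (pushMatrix H).mulVec x i ^ 2 ≤ ∑ i, x i ^ 2 := by
  simpa [pushProd] using sum_sq_pushProd_mulVec_le (G := fun _ => H) (fun _ => hH) 0 1 x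

lemma norm_sq_toEuclideanLin (A : Matrix (Fin n) (Fin n) ℝ) (x : EuclideanSpace ℝ (Fin n)) :
    ‖Matrix.toEuclideanLin A x‖ ^ 2 = ∑ i, A.mulVec x.ofLp i ^ 2 := by
  rw [EuclideanSpace.real_norm_sq_eq]
  rfl

open LinearMap in
lemma inner_adjoint_comp_self (T : EuclideanSpace ℝ (Fin n) →ₗ[ℝ] EuclideanSpace ℝ (Fin n))
    (x : EuclideanSpace ℝ (Fin n)) : inner ℝ ((adjoint T ∘ₗ T) x) x = ‖T x‖ ^ 2 := by
  rw [LinearMap.comp_apply, LinearMap.adjoint_inner_left, real_inner_self_eq_norm_sq]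

lemma sigmaTwo_nonneg (A : Matrix (Fin n) (Fin n) ℝ) : 0 ≤ sigmaTwo A :=
  LinearMap.singularValues_nonneg _ _

lemma sq_singularValues_le_one {H : Digraph (Fin n)} (hH : IsRegularDigraph H) (i : Fin n) :
    (Matrix.toEuclideanLin (pushMatrix H)).singularValues i ^ 2 ≤ 1 := by
  set T := Matrix.toEuclideanLin (pushMatrix H)
  have hn := finrank_euclideanSpace_fin (𝕜 := ℝ) (n := n)
  set hS := T.isSymmetric_adjoint_comp_self
  have h1 := inner_adjoint_comp_self T (hS.eigenvectorBasis hn i)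
  rw [hS.apply_eigenvectorBasis, inner_smul_left, real_inner_self_eq_norm_sq,
    OrthonormalBasis.norm_eq_one, norm_sq_toEuclideanLin] at h1
  rw [LinearMap.sq_singularValues_fin T hn i]
  have h2 := sum_sq_mulVec_le hH (hS.eigenvectorBasis hn i).ofLp
  rw [← EuclideanSpace.real_norm_sq_eq, OrthonormalBasis.norm_eq_one] at h2
  simp at h1 h2
  linarith

lemma sigmaTwo_le_one {H : Digraph (Fin n)} (hn : 2 ≤ n) (hH : IsRegularDigraph H) :
    sigmaTwo (pushMatrix H) ≤ 1 := by
  have h := sq_singularValues_le_one hH ⟨1, hn⟩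
  exact (sq_le_one_iff₀ (sigmaTwo_nonneg _)).1 h

/-- The push matrix of a regular graph fixes the all-ones vector, as does its transpose; on the
orthogonal complement, the vectors of zero sum, it contracts by its second singular value. -/
lemma sum_sq_mulVec_le_sigmaTwo {H : Digraph (Fin n)} (hn : 2 ≤ n) (hH : IsRegularDigraph H)
    {v : Fin n → ℝ} (hv : ∑ i, v i = 0) :
    ∑ i, (pushMatrix H).mulVec v i ^ 2 ≤ sigmaTwo (pushMatrix H) ^ 2 * ∑ i, v i ^ 2 := by
  set T := Matrix.toEuclideanLin (pushMatrix H) with hT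
  have hfr := finrank_euclideanSpace_fin (𝕜 := ℝ) (n := n)
  set hS := T.isSymmetric_adjoint_comp_self
  set b := hS.eigenvectorBasis hfr
  set ev := hS.eigenvalues hfr with hev
  have hσ : sigmaTwo (pushMatrix H) ^ 2 = ev ⟨1, hn⟩ :=
    LinearMap.sq_singularValues_fin T hfr ⟨1, hn⟩
  have hv2 : 0 ≤ ∑ i, v i ^ 2 := Finset.sum_nonneg fun i _ => sq_nonneg _
  rw [hσ]
  rcases le_or_gt 1 (ev ⟨1, hn⟩) with h1 | h1
  · exact (sum_sq_mulVec_le hH v).trans (le_mul_of_one_le_left hv2 h1)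
  set u : EuclideanSpace ℝ (Fin n) := WithLp.toLp 2 fun _ => 1 with hu
  set w : EuclideanSpace ℝ (Fin n) := WithLp.toLp 2 v with hw
  have hinner : ∀ x : EuclideanSpace ℝ (Fin n), inner ℝ x u = ∑ i, x i := by
    intro x; simp [PiLp.inner_apply, hu]
  have hTx : ∀ (x : EuclideanSpace ℝ (Fin n)) i, T x i = (pushMatrix H).mulVec x.ofLp i :=
    fun x i => rfl
  have hTu : T u = u := by
    ext i
    rw [hTx]
    simp [hu, Matrix.mulVec, dotProduct, sum_row_pushMatrix hH]
  have hSu : (LinearMap.adjoint T ∘ₗ T) u = u := by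
    rw [LinearMap.comp_apply, hTu]
    refine ext_inner_left ℝ fun x => ?_
    rw [LinearMap.adjoint_inner_right, hinner, hinner]
    simp only [hTx, sum_pushMatrix_mulVec]
  have hbu : ∀ i, i ≠ ⟨0, by omega⟩ → inner ℝ (b i) u = 0 := by
    intro i hi
    have hle : ev i ≤ ev ⟨1, hn⟩ := by
      refine hS.eigenvalues_antitone hfr ?_
      rw [Fin.le_def]
      have : (i : ℕ) ≠ 0 := fun h => hi (Fin.ext h)
      simp only; omega
    have h2 := hS (b i) u
    rw [hSu, hS.apply_eigenvectorBasis, inner_smul_left] at h2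
    have h3 : (1 - ev i) * inner ℝ (b i) u = 0 := by
      have : ev i * inner ℝ (b i) u = inner ℝ (b i) u := h2
      linarith
    rcases mul_eq_zero.1 h3 with h | h
    · linarith
    · exact h
  have hb0 : inner ℝ (b ⟨0, by omega⟩) w = 0 := by
    have h2 : ∑ i, inner ℝ u (b i) * inner ℝ (b i) w = inner ℝ u w := b.sum_inner_mul_inner u w
    rw [Finset.sum_eq_single ⟨0, by omega⟩ (fun i _ hi => by
      rw [real_inner_comm, hbu i hi, zero_mul]) (by simp), real_inner_comm w u, hinner] at h2
    have h3 : ∑ i, w i = 0 := hv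
    rw [h3] at h2
    rcases mul_eq_zero.1 h2 with h | h
    · exfalso
      have h4 : ∑ i, inner ℝ u (b i) * inner ℝ (b i) u = inner ℝ u u := b.sum_inner_mul_inner u u
      rw [Finset.sum_eq_single ⟨0, by omega⟩ (fun i _ hi => by
        rw [hbu i hi, mul_zero]) (by simp), h, zero_mul, hinner] at h4
      have : ∑ i, u i = (n : ℝ) := by simp [hu]
      rw [this] at h4
      have : (0 : ℝ) < n := by exact_mod_cast (by omega : 0 < n)
      linarith
    · exact h
  have h5 : ∑ i, (pushMatrix H).mulVec v i ^ 2 = ∑ i, ev i * inner ℝ (b i) w ^ 2 := by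
    have e1 : ∑ i, (pushMatrix H).mulVec v i ^ 2 = ‖T w‖ ^ 2 := (norm_sq_toEuclideanLin _ w).symm
    rw [e1, ← inner_adjoint_comp_self, ← b.sum_inner_mul_inner]
    refine Finset.sum_congr rfl fun i _ => ?_
    rw [hS, hS.apply_eigenvectorBasis, inner_smul_right, real_inner_comm w (b i)]
    simp only [RCLike.ofReal_real_eq_id, id]
    ring
  have h6 : ∑ i, v i ^ 2 = ∑ i, inner ℝ (b i) w ^ 2 := by
    have e1 : ∑ i, v i ^ 2 = ‖w‖ ^ 2 := (EuclideanSpace.real_norm_sq_eq w).symm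
    rw [e1, ← real_inner_self_eq_norm_sq, ← b.sum_inner_mul_inner]
    refine Finset.sum_congr rfl fun i _ => ?_
    rw [real_inner_comm w (b i), sq]
  rw [h5, h6, Finset.mul_sum]
  refine Finset.sum_le_sum fun i _ => ?_
  by_cases hi : i = ⟨0, by omega⟩
  · rw [hi, hb0]; simp
  · refine mul_le_mul_of_nonneg_right (hS.eigenvalues_antitone hfr ?_) (sq_nonneg _)
    rw [Fin.le_def]
    have : (i : ℕ) ≠ 0 := fun h => hi (Fin.ext h)
    simp only; omega

lemma abs_pushProd_mulVec_le_sigmaTwo {G : ℕ → Digraph (Fin n)} (hn : 2 ≤ n)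
    (hreg : ∀ t, IsRegularDigraph (G t)) (s k : ℕ) {v : Fin n → ℝ} (hv : ∑ j, v j = 0)
    (i : Fin n) : |(pushProd G s k).mulVec v i|
      ≤ 2 * (⨆ t, sigmaTwo (pushMatrix (G t))) ^ k * ∑ j, |v j| := by
  set σ := ⨆ t, sigmaTwo (pushMatrix (G t)) with hσ
  have hbdd : BddAbove (Set.range fun t => sigmaTwo (pushMatrix (G t))) :=
    ⟨1, by rintro _ ⟨t, rfl⟩; exact sigmaTwo_le_one hn (hreg t)⟩
  have hσ0 : 0 ≤ σ := Real.iSup_nonneg fun t => sigmaTwo_nonneg _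
  have h : ∑ i, (pushProd G s k).mulVec v i ^ 2 ≤ (σ ^ k) ^ 2 * ∑ i, v i ^ 2 := by
    induction k with
    | zero => simp [pushProd]
    | succ k ih =>
      rw [pushProd, ← Matrix.mulVec_mulVec]
      refine (sum_sq_mulVec_le_sigmaTwo hn (hreg _) (by rw [sum_pushProd_mulVec, hv])).trans ?_
      rw [pow_succ σ k, mul_pow, mul_comm ((σ ^ k) ^ 2), mul_assoc]
      exact mul_le_mul (pow_le_pow_left₀ (sigmaTwo_nonneg _) (le_ciSup hbdd _) 2) ih
        (Finset.sum_nonneg fun i _ => sq_nonneg _) (sq_nonneg σ)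
  have h1 := abs_le_of_sum_sq_le (pow_nonneg hσ0 k) h i
  have h2 : 0 ≤ σ ^ k * ∑ j, |v j| :=
    mul_nonneg (pow_nonneg hσ0 k) (Finset.sum_nonneg fun j _ => abs_nonneg _)
  linarith

end SingularValue

/-! ### The scalars `δ` and `λ` of a graph sequence -/

section Scalars

variable {n : ℕ}

lemma rpow_pos_and_lt_one {c e : ℝ} (hc0 : 0 < c) (hc1 : c < 1) (he : 0 < e) :
    0 < (1 - c) ^ e ∧ (1 - c) ^ e < 1 :=
  ⟨Real.rpow_pos_of_pos (by linarith) e, Real.rpow_lt_one (by linarith) (by linarith) he⟩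

/-- A graph sequence has a lower bound `δ` for the push-sum weights and a rate `λ` at which the
matrix products contract vectors of zero sum; for regular sequences `λ` is the least of the
general rate, the rate for doubly stochastic matrices, and the supremum of the second singular
values. -/
lemma exists_contraction_scalars {G : ℕ → Digraph (Fin n)} {B : ℕ} (hn : 2 ≤ n)
    (hG : BStronglyConnected G B) :
    ∃ δ lam : ℝ, 0 < δ ∧ 0 ≤ lam ∧ lam < 1 ∧
      (0 < lam ∨ ((∀ t, IsRegularDigraph (G t)) ∧ (⨆ t, sigmaTwo (pushMatrix (G t))) = 0)) ∧
      1 / (n : ℝ) ^ (n * B) ≤ δ ∧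
      lam ≤ (1 - 1 / (n : ℝ) ^ (n * B)) ^ (1 / ((n : ℝ) * (B : ℝ))) ∧
      ((∀ t, IsRegularDigraph (G t)) →
        δ = 1 ∧
        lam ≤ min ((1 - 1 / (4 * (n : ℝ) ^ 3)) ^ (1 / (B : ℝ)))
          (⨆ t, sigmaTwo (pushMatrix (G t)))) ∧
      δ ≤ 1 ∧ (∀ t i, δ ≤ pushY G t i) ∧
      ∀ s k (v : Fin n → ℝ), ∑ j, v j = 0 → ∀ i,
        |(pushProd G s k).mulVec v i| ≤ 2 * lam ^ k * ∑ j, |v j| := by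
  classical
  have hB := hG.1
  have hn1 : (1 : ℝ) < n := by exact_mod_cast hn
  have hB0 : (0 : ℝ) < B := by exact_mod_cast hB
  have hpow : 1 < (n : ℝ) ^ (n * B) := one_lt_pow₀ hn1 (Nat.mul_pos (by omega) hB).ne'
  have hη : 1 / (n : ℝ) ^ (n * B) < 1 := (div_lt_one (by linarith)).2 hpow
  have hη0 : 0 < 1 / (n : ℝ) ^ (n * B) := by positivity
  obtain ⟨ha0, ha1⟩ := rpow_pos_and_lt_one hη0 hη
    (show 0 < 1 / ((n : ℝ) * (B : ℝ)) by positivity)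
  set a := (1 - 1 / (n : ℝ) ^ (n * B)) ^ (1 / ((n : ℝ) * (B : ℝ)))
  by_cases hreg : ∀ t, IsRegularDigraph (G t)
  · have hn3 : 1 / (4 * (n : ℝ) ^ 3) < 1 := by
      rw [div_lt_one (by positivity)]
      have := one_lt_pow₀ hn1 (n := 3) (by norm_num)
      linarith
    obtain ⟨hb0, hb1⟩ := rpow_pos_and_lt_one (show 0 < 1 / (4 * (n : ℝ) ^ 3) by positivity) hn3
      (show 0 < 1 / (B : ℝ) by positivity)
    set b := (1 - 1 / (4 * (n : ℝ) ^ 3)) ^ (1 / (B : ℝ))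
    have hσ0 : 0 ≤ ⨆ t, sigmaTwo (pushMatrix (G t)) := Real.iSup_nonneg fun t => sigmaTwo_nonneg _
    set σ := ⨆ t, sigmaTwo (pushMatrix (G t)) with hσ
    refine ⟨1, min a (min b σ), one_pos, le_min ha0.le (le_min hb0.le hσ0),
      (min_le_left _ _).trans_lt ha1, ?_, hη.le, min_le_left _ _,
      fun _ => ⟨rfl, min_le_right _ _⟩, le_rfl, fun t i => (pushY_eq_one_of_regular hreg t i).ge,
      fun s k v hv i => ?_⟩
    · rcases hσ0.eq_or_lt with h | h
      · exact Or.inr ⟨hreg, h.symm⟩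
      · exact Or.inl (lt_min ha0 (lt_min hb0 h))
    · rcases min_choice a (min b σ) with h | h
      · rw [h]; exact abs_pushProd_mulVec_le_general hn hG s k hv i
      · rcases min_choice b σ with h' | h'
        · rw [h, h']; exact abs_pushProd_mulVec_le_regular hn hG hreg s k hv i
        · rw [h, h']; exact abs_pushProd_mulVec_le_sigmaTwo hn hreg s k hv i
  · exact ⟨1 / (n : ℝ) ^ (n * B), a, hη0, ha0.le, ha1, Or.inl ha0, le_rfl, le_rfl,
      fun h => absurd h hreg, hη.le, one_div_pow_le_pushY hG,
      fun s k v hv i => abs_pushProd_mulVec_le_general hn hG s k hv i⟩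

end Scalars

/-! ### Consensus error of perturbed push-sum -/

section PushSum

variable {n d : ℕ} {G : ℕ → Digraph (Fin n)}

/-- The effect at time `t`, through a contraction with rate `lam`, of an initial mass `S` and of
perturbations of size `b 1, …, b t`. -/
noncomputable def discountedSum (lam S : ℝ) (b : ℕ → ℝ) (t : ℕ) : ℝ :=
  lam ^ (t + 1) * S + ∑ s ∈ Finset.Icc 1 t, lam ^ (t + 1 - s) * b s

lemma discountedSum_succ (lam S : ℝ) (b : ℕ → ℝ) (t : ℕ) :
    discountedSum lam S b (t + 1) = lam * discountedSum lam S b t + lam * b (t + 1) := by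
  have h : ∑ s ∈ Finset.Icc 1 t, lam ^ (t + 1 + 1 - s) * b s
      = lam * ∑ s ∈ Finset.Icc 1 t, lam ^ (t + 1 - s) * b s := by
    rw [Finset.mul_sum]
    refine Finset.sum_congr rfl fun s hs => ?_
    have := (Finset.mem_Icc.1 hs).2
    rw [show t + 1 + 1 - s = (t + 1 - s) + 1 by omega, pow_succ]
    ring
  rw [discountedSum, Finset.sum_Icc_succ_top (by omega), h, discountedSum,
    show t + 1 + 1 - (t + 1) = 1 by omega]
  ring

lemma discountedSum_nonneg {lam S : ℝ} {b : ℕ → ℝ} (hlam : 0 ≤ lam) (hS : 0 ≤ S)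
    (hb : ∀ s, 0 ≤ b s) (t : ℕ) : 0 ≤ discountedSum lam S b t :=
  add_nonneg (mul_nonneg (pow_nonneg hlam _) hS)
    (Finset.sum_nonneg fun s _ => mul_nonneg (pow_nonneg hlam _) (hb s))

lemma sum_discountedSum_le {lam S : ℝ} {b : ℕ → ℝ} (hlam : 0 ≤ lam) (hlam1 : lam < 1)
    (hS : 0 ≤ S) (hb : ∀ s, 0 ≤ b s) (T : ℕ) :
    ∑ t ∈ Finset.Icc 1 T, discountedSum lam S b t
      ≤ lam / (1 - lam) * (S + ∑ s ∈ Finset.Icc 1 T, b s) := by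
  set c := lam / (1 - lam) with hc
  have h1 : 0 < 1 - lam := by linarith
  have hc0 : 0 ≤ c := div_nonneg hlam h1.le
  have hcl : (1 + c) * lam = c := by rw [hc]; field_simp; ring
  have key : ∑ t ∈ Finset.Icc 1 T, discountedSum lam S b t + c * discountedSum lam S b T
      = c * (lam * S + ∑ s ∈ Finset.Icc 1 T, b s) := by
    induction T with
    | zero => simp [discountedSum]
    | succ T ih =>
      rw [Finset.sum_Icc_succ_top (by omega), Finset.sum_Icc_succ_top (by omega),
        discountedSum_succ]
      linear_combination ih + (discountedSum lam S b T + b (T + 1)) * hcl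
  have h2 := mul_nonneg hc0 (discountedSum_nonneg hlam hS hb T)
  have h3 : lam * S ≤ S := mul_le_of_le_one_left hS hlam1.le
  have h4 : c * (lam * S + ∑ s ∈ Finset.Icc 1 T, b s) ≤ c * (S + ∑ s ∈ Finset.Icc 1 T, b s) := by
    gcongr
  linarith

lemma pushY_nonneg (t : ℕ) (i : Fin n) : 0 ≤ pushY G t i := by
  rw [pushY_eq_pushProd_mulVec]
  simp only [Matrix.mulVec, dotProduct]
  exact Finset.sum_nonneg fun j _ => mul_nonneg (pushProd_nonneg _ _ _ _ _) zero_le_one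

/-- Subtracting from a vector its sum, distributed according to the weights `y`, leaves a vector
of zero sum. -/
lemma sum_sub_mul_pushY (hn : 0 < n) (t : ℕ) (e : Fin n → ℝ) :
    ∑ i, (e i - (∑ j, e j) / n * pushY G t i) = 0 := by
  have : (n : ℝ) ≠ 0 := by exact_mod_cast hn.ne'
  rw [Finset.sum_sub_distrib, ← Finset.mul_sum, sum_pushY]
  field_simp
  ring

lemma sum_abs_sub_mul_pushY_le (hn : 0 < n) (t : ℕ) (e : Fin n → ℝ) :
    ∑ i, |e i - (∑ j, e j) / n * pushY G t i| ≤ 2 * ∑ i, |e i| := by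
  have hn0 : (0 : ℝ) < n := by exact_mod_cast hn
  calc ∑ i, |e i - (∑ j, e j) / n * pushY G t i|
      ≤ ∑ i, (|e i| + |∑ j, e j| / n * pushY G t i) := by
        refine Finset.sum_le_sum fun i _ => (abs_sub _ _).trans_eq ?_
        rw [abs_mul, abs_div, abs_of_nonneg (pushY_nonneg t i), abs_of_pos hn0]
    _ = ∑ i, |e i| + |∑ j, e j| := by
        rw [Finset.sum_add_distrib, ← Finset.mul_sum, sum_pushY]
        field_simp
    _ ≤ 2 * ∑ i, |e i| := by
        rw [two_mul]
        gcongr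
        exact Finset.abs_sum_le_sum_abs _ _

/-- Perturbed push-sum in one dimension: after subtracting the mean, distributed according to the
weights, every perturbation is a vector of zero sum, which the matrix products contract. -/
lemma abs_mulVec_sub_mean_mul_pushY_le (hn : 0 < n) {lam : ℝ} (hlam : 0 ≤ lam)
    (hcon : ∀ s k (v : Fin n → ℝ), ∑ j, v j = 0 → ∀ i,
      |(pushProd G s k).mulVec v i| ≤ 2 * lam ^ k * ∑ j, |v j|)
    {x e : ℕ → Fin n → ℝ} (hx : ∀ t, x (t + 1) = (pushMatrix (G t)).mulVec (x t) + e (t + 1))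
    (t : ℕ) (i : Fin n) :
    |(pushMatrix (G t)).mulVec (x t) i - (∑ j, x t j) / n * pushY G (t + 1) i|
      ≤ 4 * discountedSum lam (∑ j, |x 0 j|) (fun s => ∑ j, |e s j|) t := by
  set η : ℕ → (Fin n → ℝ) → Fin n → ℝ := fun s v => v - ((∑ j, v j) / n) • pushY G s with hη
  have hrec : ∀ t, η t (x t) = (pushProd G 0 t).mulVec (η 0 (x 0))
      + ∑ s ∈ Finset.Icc 1 t, (pushProd G s (t - s)).mulVec (η s (e s)) := by
    intro t
    induction t with
    | zero => simp [pushProd]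
    | succ t ih =>
      have h1 : η (t + 1) (x (t + 1))
          = (pushMatrix (G t)).mulVec (η t (x t)) + η (t + 1) (e (t + 1)) := by
        simp only [hη, hx t, Pi.add_apply, Finset.sum_add_distrib, sum_pushMatrix_mulVec,
          pushY_succ_eq_mulVec, Matrix.mulVec_sub, Matrix.mulVec_smul, add_div, add_smul]
        abel
      rw [h1, ih, Matrix.mulVec_add, Matrix.mulVec_mulVec, Finset.sum_Icc_succ_top (by omega),
        ← add_assoc]
      congr 1
      · congr 1
        · rw [pushProd, zero_add]
        · rw [← Matrix.mulVecLin_apply, map_sum]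
          refine Finset.sum_congr rfl fun s hs => ?_
          have := (Finset.mem_Icc.1 hs).2
          rw [Matrix.mulVecLin_apply, Matrix.mulVec_mulVec,
            show t + 1 - s = (t - s) + 1 by omega, pushProd, show s + (t - s) = t by omega]
      · simp [pushProd]
  have h2 : (pushMatrix (G t)).mulVec (x t) i - (∑ j, x t j) / n * pushY G (t + 1) i
      = (pushProd G 0 (t + 1)).mulVec (η 0 (x 0)) i
        + ∑ s ∈ Finset.Icc 1 t, (pushProd G s (t + 1 - s)).mulVec (η s (e s)) i := by
    have h3 : (pushMatrix (G t)).mulVec (η t (x t)) i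
        = (pushMatrix (G t)).mulVec (x t) i - (∑ j, x t j) / n * pushY G (t + 1) i := by
      simp only [hη, Matrix.mulVec_sub, Matrix.mulVec_smul, ← pushY_succ_eq_mulVec, Pi.sub_apply,
        Pi.smul_apply, smul_eq_mul]
    rw [← h3, hrec, Matrix.mulVec_add, Matrix.mulVec_mulVec, Pi.add_apply]
    congr 1
    · rw [pushProd, zero_add]
    · rw [← Matrix.mulVecLin_apply, map_sum, Finset.sum_apply]
      refine Finset.sum_congr rfl fun s hs => ?_
      have := (Finset.mem_Icc.1 hs).2
      rw [Matrix.mulVecLin_apply, Matrix.mulVec_mulVec,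
        show t + 1 - s = (t - s) + 1 by omega, pushProd, show s + (t - s) = t by omega]
  have h4 : ∀ s k (v : Fin n → ℝ), |(pushProd G s k).mulVec (η s v) i|
      ≤ 4 * (lam ^ k * ∑ j, |v j|) := by
    intro s k v
    refine (hcon s k _ (sum_sub_mul_pushY hn s v) i).trans ?_
    have h5 := sum_abs_sub_mul_pushY_le (G := G) hn s v
    have h6 : 0 ≤ 2 * lam ^ k := by positivity
    calc 2 * lam ^ k * ∑ j, |η s v j| ≤ 2 * lam ^ k * (2 * ∑ j, |v j|) :=
          mul_le_mul_of_nonneg_left h5 h6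
      _ = _ := by ring
  rw [h2, discountedSum, mul_add, Finset.mul_sum (Finset.Icc 1 t)]
  refine (abs_add_le _ _).trans (add_le_add (h4 _ _ _) ?_)
  exact (Finset.abs_sum_le_sum_abs _ _).trans (Finset.sum_le_sum fun s _ => h4 _ _ _)

lemma norm_le_l1Norm (x : EuclideanSpace ℝ (Fin d)) : ‖x‖ ≤ l1Norm x := by
  have h0 : 0 ≤ l1Norm x := Finset.sum_nonneg fun k _ => abs_nonneg _
  rw [EuclideanSpace.norm_eq, Real.sqrt_le_left h0]
  simpa [l1Norm] using Finset.sum_sq_le_sq_sum_of_nonneg (s := Finset.univ) (f := fun k => |x k|)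
      fun j _ => abs_nonneg _

lemma l1Norm_nonneg (x : EuclideanSpace ℝ (Fin d)) : 0 ≤ l1Norm x :=
  Finset.sum_nonneg fun _ _ => abs_nonneg _

lemma l1Norm_le (x : EuclideanSpace ℝ (Fin d)) : l1Norm x ≤ √(d : ℝ) * ‖x‖ := by
  rw [EuclideanSpace.norm_eq, ← Real.sqrt_mul (by positivity)]
  apply Real.le_sqrt_of_sq_le
  simpa [l1Norm] using sq_sum_le_card_mul_sum_sq (s := Finset.univ) (f := fun k => |x k|)

lemma l1Norm_smul (c : ℝ) (x : EuclideanSpace ℝ (Fin d)) : l1Norm (c • x) = |c| * l1Norm x := by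
  simp [l1Norm, abs_mul, Finset.mul_sum]

lemma pushMix_apply (H : Digraph (Fin n)) (x : Fin n → EuclideanSpace ℝ (Fin d)) (i : Fin n)
    (k : Fin d) : pushMix H x i k = (pushMatrix H).mulVec (fun j => x j k) i := by
  rw [pushMatrix_mulVec, pushMix]
  simp only [WithLp.ofLp_sum, WithLp.ofLp_smul, Finset.sum_apply, Pi.smul_apply, smul_eq_mul]
  exact Finset.sum_congr rfl fun j _ => by rw [div_eq_inv_mul]

lemma sum_pushMix (H : Digraph (Fin n)) (x : Fin n → EuclideanSpace ℝ (Fin d)) :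
    ∑ i, pushMix H x i = ∑ i, x i := by
  ext k
  simp only [WithLp.ofLp_sum, Finset.sum_apply, pushMix_apply, sum_pushMatrix_mulVec]

/-- The average `(1/n) ∑ xᵢ`. -/
noncomputable def nodeMean (x : Fin n → EuclideanSpace ℝ (Fin d)) : EuclideanSpace ℝ (Fin d) :=
  (n : ℝ)⁻¹ • ∑ i, x i

variable (α : ℕ → ℝ) (g : Fin n → ℕ → EuclideanSpace ℝ (Fin d) → EuclideanSpace ℝ (Fin d))
  (x0 : Fin n → EuclideanSpace ℝ (Fin d))

lemma pushX_succ (t : ℕ) (i : Fin n) : pushX G α g x0 (t + 1) i =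
    pushMix (G t) (pushX G α g x0 t) i
      - α (t + 1) • g i (t + 1) (pushZ G α g x0 (t + 1) i) := rfl

lemma nodeMean_pushX_succ (t : ℕ) : nodeMean (pushX G α g x0 (t + 1))
    = nodeMean (pushX G α g x0 t)
      - (α (t + 1) / n) • ∑ i, g i (t + 1) (pushZ G α g x0 (t + 1) i) := by
  simp only [nodeMean, pushX_succ, Finset.sum_sub_distrib, sum_pushMix, smul_sub,
    ← Finset.smul_sum, smul_smul]
  rw [div_eq_inv_mul]

/-- The average of the `xᵢ(t)` is a convex combination of the `zᵢ(t + 1)`. -/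
lemma nodeMean_pushX_eq (hy : ∀ t i, 0 < pushY G t i) (t : ℕ) : nodeMean (pushX G α g x0 t)
    = ∑ i, ((n : ℝ)⁻¹ * pushY G (t + 1) i) • pushZ G α g x0 (t + 1) i := by
  rw [nodeMean, ← sum_pushMix (G t), Finset.smul_sum]
  refine Finset.sum_congr rfl fun i _ => ?_
  rw [pushZ, smul_smul, mul_assoc, mul_inv_cancel₀ (hy _ _).ne', mul_one]

lemma norm_nodeMean_pushX_le (hn : 0 < n) (hy : ∀ t i, 0 < pushY G t i) {t : ℕ} {D : ℝ}
    (hz : ∀ i, ‖pushZ G α g x0 (t + 1) i‖ ≤ D) : ‖nodeMean (pushX G α g x0 t)‖ ≤ D := by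
  rw [nodeMean_pushX_eq _ _ _ hy]
  have hn0 : (n : ℝ) ≠ 0 := by exact_mod_cast hn.ne'
  have hnn : ∀ i, 0 ≤ (n : ℝ)⁻¹ * pushY G (t + 1) i := fun i =>
    mul_nonneg (by positivity) (hy _ _).le
  calc _ ≤ ∑ i, (n : ℝ)⁻¹ * pushY G (t + 1) i * D := by
        refine norm_sum_le_of_le _ fun i _ => ?_
        rw [norm_smul, Real.norm_of_nonneg (hnn i)]
        exact mul_le_mul_of_nonneg_left (hz i) (hnn i)
    _ = D := by
        rw [← Finset.sum_mul, ← Finset.mul_sum, sum_pushY, inv_mul_cancel₀ hn0, one_mul]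

/-- The distance of the `zᵢ(t + 1)` from the average of the `xⱼ(t)`. -/
lemma norm_pushZ_sub_nodeMean_le (hn : 0 < n) {δ lam : ℝ} (hδ : 0 < δ) (hlam : 0 ≤ lam)
    (hy : ∀ t i, δ ≤ pushY G t i)
    (hcon : ∀ s k (v : Fin n → ℝ), ∑ j, v j = 0 → ∀ i,
      |(pushProd G s k).mulVec v i| ≤ 2 * lam ^ k * ∑ j, |v j|)
    (t : ℕ) (i : Fin n) {b : ℕ → ℝ} (hb : ∀ s ∈ Finset.Icc 1 t,
      |α s| * ∑ j, l1Norm (g j s (pushZ G α g x0 s j)) ≤ b s) :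
    ‖pushZ G α g x0 (t + 1) i - nodeMean (pushX G α g x0 t)‖
      ≤ 4 / δ * discountedSum lam (∑ j, l1Norm (x0 j)) b t := by
  have hn0 : (n : ℝ) ≠ 0 := by exact_mod_cast hn.ne'
  set X := pushX G α g x0
  set e : ℕ → Fin n → EuclideanSpace ℝ (Fin d) :=
    fun s j => -(α s • g j s (pushZ G α g x0 s j)) with he
  have hyi : 0 < pushY G (t + 1) i := hδ.trans_le (hy _ _)
  have hcoord : ∀ k, |(pushZ G α g x0 (t + 1) i - nodeMean (X t)) k|
      ≤ 4 / δ * discountedSum lam (∑ j, |x0 j k|) (fun s => ∑ j, |e s j k|) t := by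
    intro k
    have h1 := abs_mulVec_sub_mean_mul_pushY_le hn hlam hcon (x := fun t j => X t j k)
      (e := fun t j => e t j k) (fun t => by
        ext j
        simp only [Pi.add_apply, ← pushMix_apply]
        simp only [X, pushX_succ, he]
        simp [sub_eq_add_neg]) t i
    have h2 : (pushZ G α g x0 (t + 1) i - nodeMean (X t)) k = (pushY G (t + 1) i)⁻¹ *
        ((pushMatrix (G t)).mulVec (fun j => X t j k) i
          - (∑ j, X t j k) / n * pushY G (t + 1) i) := by
      rw [← pushMix_apply]
      simp only [pushZ, nodeMean, PiLp.sub_apply, PiLp.smul_apply, smul_eq_mul, WithLp.ofLp_sum,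
        Finset.sum_apply]
      change _ = (pushY G (t + 1) i)⁻¹ * ((pushMix (G t) (pushX G α g x0 t) i).ofLp k - _)
      field_simp
    rw [h2, abs_mul, abs_of_pos (inv_pos.2 hyi)]
    have h3 : (pushY G (t + 1) i)⁻¹ ≤ δ⁻¹ := inv_anti₀ hδ (hy _ _)
    refine (mul_le_mul h3 h1 (abs_nonneg _) (by positivity)).trans_eq ?_
    simp only [X, pushX]
    ring
  refine (norm_le_l1Norm _).trans ((Finset.sum_le_sum fun k _ => hcoord k).trans ?_)
  rw [← Finset.mul_sum]
  refine mul_le_mul_of_nonneg_left ?_ (by positivity)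
  simp only [discountedSum, Finset.sum_add_distrib, ← Finset.mul_sum]
  refine add_le_add (le_of_eq ?_) ?_
  · rw [Finset.sum_comm]; rfl
  · rw [Finset.sum_comm]
    refine Finset.sum_le_sum fun s hs => ?_
    rw [← Finset.mul_sum]
    refine mul_le_mul_of_nonneg_left ?_ (pow_nonneg hlam _)
    refine le_trans (le_of_eq ?_) (hb s hs)
    rw [Finset.sum_comm, Finset.mul_sum]
    refine Finset.sum_congr rfl fun j _ => ?_
    rw [← l1Norm_smul]
    simp [he, l1Norm]

end PushSum

/-! ### Strong convexity and subgradients -/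

section StrongConvexity

variable {n d : ℕ}

/-- Strong convexity improves the subgradient inequality by a quadratic term. -/
lemma IsSubgradient.add_sq_le {f : EuclideanSpace ℝ (Fin d) → ℝ} {m : ℝ}
    (hf : StrongConvexOn Set.univ m f) {u g : EuclideanSpace ℝ (Fin d)} (hg : IsSubgradient f u g)
    (v : EuclideanSpace ℝ (Fin d)) : f u + inner ℝ g (v - u) + m / 2 * ‖v - u‖ ^ 2 ≤ f v := by
  have h : ∀ s ∈ Set.Ioo (0 : ℝ) 1,
      f u + inner ℝ g (v - u) + (1 - s) * (m / 2 * ‖v - u‖ ^ 2) ≤ f v := by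
    intro s hs
    have h1 := hf.2 (Set.mem_univ u) (Set.mem_univ v) (sub_nonneg.2 hs.2.le) hs.1.le
      (sub_add_cancel 1 s)
    have h2 := hg ((1 - s) • u + s • v)
    rw [show (1 - s) • u + s • v - u = s • (v - u) by module, inner_smul_right] at h2
    rw [norm_sub_rev u v] at h1
    simp only [smul_eq_mul] at h1
    have h3 : s * (f u + inner ℝ g (v - u) + (1 - s) * (m / 2 * ‖v - u‖ ^ 2)) ≤ s * f v := by
      linarith
    exact le_of_mul_le_mul_left h3 hs.1
  have hlim : Filter.Tendsto
      (fun s : ℝ => f u + inner ℝ g (v - u) + (1 - s) * (m / 2 * ‖v - u‖ ^ 2))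
      (nhdsWithin 0 (Set.Ioi 0))
      (nhds (f u + inner ℝ g (v - u) + (1 - 0) * (m / 2 * ‖v - u‖ ^ 2))) :=
    Filter.Tendsto.mono_left (Continuous.tendsto (by fun_prop) 0) nhdsWithin_le_nhds
  rw [sub_zero, one_mul] at hlim
  exact le_of_tendsto hlim (Filter.eventually_of_mem (Ioo_mem_nhdsGT one_pos) h)

lemma strongConvexOn_sum {f : Fin n → EuclideanSpace ℝ (Fin d) → ℝ} {μ : Fin n → ℝ}
    (hf : ∀ j, StrongConvexOn Set.univ (μ j) (f j)) :
    StrongConvexOn Set.univ (∑ j, μ j) fun v => ∑ j, f j v := by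
  refine ⟨convex_univ, fun x hx y hy a b ha hb hab => ?_⟩
  refine (Finset.sum_le_sum fun j _ => (hf j).2 hx hy ha hb hab).trans_eq ?_
  simp only [Finset.sum_sub_distrib, Finset.sum_add_distrib, smul_eq_mul, Finset.mul_sum,
    Finset.sum_div, Finset.sum_mul]

lemma StrongConvexOn.convexOn_univ {f : EuclideanSpace ℝ (Fin d) → ℝ} {m : ℝ} (hm : 0 ≤ m)
    (hf : StrongConvexOn Set.univ m f) : ConvexOn ℝ Set.univ f :=
  strongConvexOn_zero.1 (hf.mono hm)

/-- A strongly convex function with a subgradient at the origin attains its minimum. -/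
lemma exists_forall_le_of_strongConvexOn {F : EuclideanSpace ℝ (Fin d) → ℝ} {m : ℝ} (hm : 0 < m)
    (hF : StrongConvexOn Set.univ m F) {g : EuclideanSpace ℝ (Fin d)}
    (hg : IsSubgradient F 0 g) : ∃ zs, ∀ v, F zs ≤ F v := by
  have hc : Continuous F := (hF.convexOn_univ hm.le).locallyLipschitz.continuous
  refine hc.exists_forall_le' 0 ?_
  filter_upwards [(tendsto_norm_cocompact_atTop (E := EuclideanSpace ℝ (Fin d))).eventually_ge_atTop
    (2 * ‖g‖ / m)] with v hv
  have h1 := hg.add_sq_le hF v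
  rw [sub_zero] at h1
  have h2 := (abs_le.1 (abs_real_inner_le_norm g v)).1
  have h3 : 2 * ‖g‖ ≤ ‖v‖ * m := (div_le_iff₀ hm).1 hv
  nlinarith [norm_nonneg v]

lemma maxSubgradNorm_nonneg (f : EuclideanSpace ℝ (Fin d) → ℝ) (D : ℝ) :
    0 ≤ maxSubgradNorm f D :=
  Real.sSup_nonneg (by rintro _ ⟨u, g, -, -, rfl⟩; exact norm_nonneg g)

/-- The subgradients of a finite convex function on a ball are bounded, hence bounded by
`maxSubgradNorm`. -/
lemma IsSubgradient.norm_le {f : EuclideanSpace ℝ (Fin d) → ℝ} (hf : ConvexOn ℝ Set.univ f)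
    {D : ℝ} {u g : EuclideanSpace ℝ (Fin d)} (hg : IsSubgradient f u g) (hu : ‖u‖ ≤ D) :
    ‖g‖ ≤ maxSubgradNorm f D := by
  refine le_csSup ?_ ⟨u, g, hu, hg, rfl⟩
  obtain ⟨C, hC⟩ := (isCompact_closedBall (0 : EuclideanSpace ℝ (Fin d))
    (D + 1)).exists_bound_of_continuousOn hf.locallyLipschitz.continuous.continuousOn
  refine ⟨2 * C, ?_⟩
  rintro _ ⟨u, g, hu, hg, rfl⟩
  have hle := hg (u + ‖g‖⁻¹ • g)
  have h1 : inner ℝ g (‖g‖⁻¹ • g) = ‖g‖ := by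
    rw [inner_smul_right, real_inner_self_eq_norm_sq, sq]
    rcases eq_or_ne ‖g‖ 0 with h | h
    · simp [h]
    · field_simp
  have h2 : ‖‖g‖⁻¹ • g‖ ≤ 1 := by
    rw [norm_smul, norm_inv, norm_norm]
    exact inv_mul_le_one
  rw [add_sub_cancel_left, h1] at hle
  have h3 := hC u (by rw [mem_closedBall_zero_iff]; linarith)
  have h4 := hC (u + ‖g‖⁻¹ • g)
    (by rw [mem_closedBall_zero_iff]; exact (norm_add_le _ _).trans (by linarith))
  rw [Real.norm_eq_abs] at h3 h4
  linarith [(abs_le.1 h3).1, (abs_le.1 h4).2]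

/-- In dimension `0` all subgradients vanish; otherwise `√d ≥ 1`. -/
lemma maxSubgradNorm_le_sqrt_mul (f : EuclideanSpace ℝ (Fin d) → ℝ) (D : ℝ) :
    maxSubgradNorm f D ≤ √(d : ℝ) * maxSubgradNorm f D := by
  rcases Nat.eq_zero_or_pos d with rfl | hd
  · have : maxSubgradNorm f D ≤ 0 := Real.sSup_le (by
      rintro _ ⟨u, g, -, -, rfl⟩
      rw [Subsingleton.elim g 0, norm_zero]) le_rfl
    simpa using this
  · refine le_mul_of_one_le_left (maxSubgradNorm_nonneg f D) ?_
    rw [Real.one_le_sqrt]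
    exact_mod_cast hd

/-- The terms of the squared distance after one step that involve the noise `v j`, for the step
size `a`, at the subgradients `g j` and the deviation `w` of the mean from the minimizer. -/
noncomputable def noiseTerm (a : ℝ) (w : EuclideanSpace ℝ (Fin d))
    (g v : Fin n → EuclideanSpace ℝ (Fin d)) : ℝ :=
  -(2 * a) * inner ℝ (∑ j, v j) w
    + a ^ 2 * (2 * inner ℝ (∑ j, g j) (∑ j, v j) + ‖∑ j, v j‖ ^ 2)

/-- The progress of one step: the squared distance of the mean `x` from the minimizer `zs`
contracts and decreases by the suboptimality at the points `z j`, up to the disagreement `ε`, the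
squared subgradients and the noise. -/
lemma norm_step_sub_sq_le {f : Fin n → EuclideanSpace ℝ (Fin d) → ℝ} {μ : Fin n → ℝ}
    {sg : Fin n → EuclideanSpace ℝ (Fin d) → EuclideanSpace ℝ (Fin d)} {D : ℝ}
    (hμ : ∀ j, 0 < μ j) (hf : ∀ j, StrongConvexOn Set.univ (μ j) (f j))
    (hsg : ∀ j u, IsSubgradient (f j) u (sg j u)) {zs : EuclideanSpace ℝ (Fin d)}
    (hzs : ∀ v, ∑ j, f j zs ≤ ∑ j, f j v) {x : EuclideanSpace ℝ (Fin d)}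
    {z v : Fin n → EuclideanSpace ℝ (Fin d)} (hx : ‖x‖ ≤ D) (hz : ∀ j, ‖z j‖ ≤ D) {ε a : ℝ}
    (hε : ∀ j, ‖z j - x‖ ≤ ε) (ha : 0 ≤ a) (i : Fin n) :
    ‖x - a • ∑ j, (sg j (z j) + v j) - zs‖ ^ 2
      ≤ (1 - a * (∑ j, μ j) / 2) * ‖x - zs‖ ^ 2
        - a * (∑ j, f j (z i) - ∑ j, f j zs + ∑ j, μ j * ‖z j - zs‖ ^ 2)
        + a * (5 * (∑ j, maxSubgradNorm (f j) D) * ε)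
        + a ^ 2 * (∑ j, maxSubgradNorm (f j) D) ^ 2
        + noiseTerm a (x - zs) (fun j => sg j (z j)) v := by
  set L : Fin n → ℝ := fun j => maxSubgradNorm (f j) D with hL
  have hsgL : ∀ j u, ‖u‖ ≤ D → ‖sg j u‖ ≤ L j := fun j u hu =>
    (hsg j u).norm_le ((hf j).convexOn_univ (hμ j).le) hu
  -- a subgradient at a point of the ball has inner product at least `-L j * ε` with a short vector
  have hin : ∀ j u w, ‖u‖ ≤ D → ‖w‖ ≤ ε → -(L j * ε) ≤ inner ℝ (sg j u) w := by
    intro j u w hu hw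
    have h1 := (abs_le.1 (abs_real_inner_le_norm (sg j u) w)).1
    have h2 : ‖sg j u‖ * ‖w‖ ≤ L j * ε :=
      mul_le_mul (hsgL j u hu) hw (norm_nonneg _) ((norm_nonneg _).trans (hsgL j u hu))
    linarith
  have hj : ∀ j, f j x - f j zs + (f j (z i) - f j zs) + μ j * ‖z j - zs‖ ^ 2 - 5 * (L j * ε)
      ≤ 2 * inner ℝ (sg j (z j)) (x - zs) := by
    intro j
    have h1 := (hsg j (z j)).add_sq_le (hf j) zs
    have h2 := hin j (z j) (x - z j) (hz j) (by rw [norm_sub_rev]; exact hε j)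
    have h3 := hsg j x (z j)
    have h4 := hin j x (z j - x) hx (hε j)
    have h5 := hsg j (z i) x
    have h6 := hin j (z i) (x - z i) (hz i) (by rw [norm_sub_rev]; exact hε i)
    have h7 : inner ℝ (sg j (z j)) (x - zs)
        = inner ℝ (sg j (z j)) (x - z j) - inner ℝ (sg j (z j)) (zs - z j) := by
      rw [← inner_sub_right]; congr 1; abel
    rw [norm_sub_rev zs] at h1
    linarith
  have hsum := Finset.sum_le_sum fun j (_ : j ∈ Finset.univ) => hj j
  simp only [Finset.sum_sub_distrib, Finset.sum_add_distrib, ← Finset.mul_sum, ← Finset.sum_mul,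
    ← sum_inner] at hsum
  have hF0 : IsSubgradient (fun v => ∑ j, f j v) zs 0 := fun v => by
    simpa using hzs v
  have hF := hF0.add_sq_le (strongConvexOn_sum hf) x
  rw [inner_zero_left, add_zero] at hF
  have hg : ‖∑ j, sg j (z j)‖ ^ 2 ≤ (∑ j, L j) ^ 2 :=
    pow_le_pow_left₀ (norm_nonneg _) (norm_sum_le_of_le _ fun j _ => hsgL j _ (hz j)) 2
  have hexp : ‖x - a • ∑ j, (sg j (z j) + v j) - zs‖ ^ 2
      = ‖x - zs‖ ^ 2 - a * (2 * inner ℝ (∑ j, sg j (z j)) (x - zs))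
        + a ^ 2 * ‖∑ j, sg j (z j)‖ ^ 2 + noiseTerm a (x - zs) (fun j => sg j (z j)) v := by
    rw [show x - a • ∑ j, (sg j (z j) + v j) - zs = (x - zs) - a • ∑ j, (sg j (z j) + v j) by abel,
      norm_sub_sq_real, Finset.sum_add_distrib, norm_smul, inner_smul_right, mul_pow,
      norm_add_sq_real, inner_add_right, Real.norm_eq_abs, sq_abs, noiseTerm,
      real_inner_comm (x - zs) (∑ j, v j), real_inner_comm (x - zs) (∑ j, sg j (z j))]
    ring
  rw [hexp]
  have h1 := mul_le_mul_of_nonneg_left hsum ha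
  have h2 := mul_le_mul_of_nonneg_left hF ha
  have h3 := mul_le_mul_of_nonneg_left hg (sq_nonneg a)
  linarith

/-- Summation of the progress inequality with weights `t (t + 1)`: the step size `p / (t + 1)` is
large enough for the weighted squared distances `t (t - 1) U t` to telescope. -/
lemma sum_mul_le_of_step {U R e σ : ℕ → ℝ} {q m Q : ℝ} (hU : ∀ t, 0 ≤ U t) (hqm : 4 ≤ q * m)
    (h : ∀ t, U (t + 1) ≤ (1 - q / (t + 1) * m / 2) * U t - q / (t + 1) * R (t + 1)
      + q / (t + 1) * e t + (q / (t + 1)) ^ 2 * Q + σ t) (T : ℕ) :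
    q * ∑ t ∈ Finset.Icc 1 T, (t : ℝ) * R (t + 1)
      ≤ ∑ t ∈ Finset.Icc 1 T,
        (q * (t * e t) + q ^ 2 * Q * (t / (t + 1)) + t * (t + 1) * σ t) := by
  have key : (T + 1) * T * U (T + 1) + q * ∑ t ∈ Finset.Icc 1 T, (t : ℝ) * R (t + 1)
      ≤ ∑ t ∈ Finset.Icc 1 T,
        (q * (t * e t) + q ^ 2 * Q * (t / (t + 1)) + t * (t + 1) * σ t) := by
    induction T with
    | zero => simp
    | succ T ih =>
      rw [Finset.sum_Icc_succ_top (by omega), Finset.sum_Icc_succ_top (by omega)]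
      have h1 := h (T + 1)
      set s : ℝ := ((T + 1 : ℕ) : ℝ) with hs
      have hsT : s = (T : ℝ) + 1 := by rw [hs]; push_cast; ring
      have hs0 : 0 ≤ s := by positivity
      have h2 := mul_le_mul_of_nonneg_left h1 (show 0 ≤ s * (s + 1) by positivity)
      have h3 : s * (s + 1) * ((1 - q / (s + 1) * m / 2) * U (T + 1)
          - q / (s + 1) * R (T + 1 + 1) + q / (s + 1) * e (T + 1) + (q / (s + 1)) ^ 2 * Q
          + σ (T + 1)) = s * (s + 1 - q * m / 2) * U (T + 1) - q * (s * R (T + 1 + 1))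
          + (q * (s * e (T + 1)) + q ^ 2 * Q * (s / (s + 1)) + s * (s + 1) * σ (T + 1)) := by
        field_simp
        ring
      rw [h3] at h2
      have h4 : s * (s + 1 - q * m / 2) * U (T + 1) ≤ (T + 1) * T * U (T + 1) := by
        refine mul_le_mul_of_nonneg_right ?_ (hU _)
        rw [hsT]
        have : (0 : ℝ) ≤ T := by positivity
        nlinarith
      have h5 : (s + 1) * s * U (T + 1 + 1) = s * (s + 1) * U (T + 1 + 1) := by ring
      linarith
  have : 0 ≤ (T + 1) * T * U (T + 1) := mul_nonneg (by positivity) (hU _)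
  linarith

end StrongConvexity

/-! ### The weighted averages -/

section WeightedAverage

variable {n d : ℕ}

lemma sum_Icc_sub_one_mul (R : ℕ → ℝ) (T : ℕ) :
    ∑ s ∈ Finset.Icc 1 (T + 1), ((s : ℝ) - 1) * R s
      = ∑ t ∈ Finset.Icc 1 T, (t : ℝ) * R (t + 1) := by
  induction T with
  | zero => simp
  | succ T ih =>
    rw [Finset.sum_Icc_succ_top (by omega), ih, Finset.sum_Icc_succ_top (by omega)]
    push_cast; ring

/-- The weight of `z s` in `weightedAvg z τ`. -/
noncomputable def avgWeight (τ s : ℕ) : ℝ := ((τ : ℝ) * ((τ : ℝ) - 1) / 2)⁻¹ * ((s : ℝ) - 1)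

lemma weightedAvg_eq (z : ℕ → EuclideanSpace ℝ (Fin d)) (τ : ℕ) :
    weightedAvg z τ = ∑ s ∈ Finset.Icc 1 τ, avgWeight τ s • z s := by
  simp only [weightedAvg, avgWeight, Finset.smul_sum, smul_smul]

lemma avgWeight_nonneg {τ s : ℕ} (hτ : 1 ≤ τ) (hs : s ∈ Finset.Icc 1 τ) : 0 ≤ avgWeight τ s := by
  have h1 : (1 : ℝ) ≤ s := by exact_mod_cast (Finset.mem_Icc.1 hs).1
  have h2 : (1 : ℝ) ≤ τ := by exact_mod_cast hτ
  exact mul_nonneg (inv_nonneg.2 (by nlinarith)) (by linarith)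

lemma sum_avgWeight {τ : ℕ} (hτ : 2 ≤ τ) : ∑ s ∈ Finset.Icc 1 τ, avgWeight τ s = 1 := by
  have h2 : (2 : ℝ) ≤ τ := by exact_mod_cast hτ
  have h : ∀ T : ℕ, ∑ s ∈ Finset.Icc 1 T, ((s : ℝ) - 1) = (T : ℝ) * ((T : ℝ) - 1) / 2 := by
    intro T
    induction T with
    | zero => simp
    | succ T ih => rw [Finset.sum_Icc_succ_top (by omega), ih]; push_cast; ring
  simp only [avgWeight, ← Finset.mul_sum, h]
  exact inv_mul_cancel₀ (by nlinarith)

lemma map_weightedAvg_le {f : EuclideanSpace ℝ (Fin d) → ℝ} (hf : ConvexOn ℝ Set.univ f)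
    (z : ℕ → EuclideanSpace ℝ (Fin d)) {τ : ℕ} (hτ : 2 ≤ τ) :
    f (weightedAvg z τ) ≤ ∑ s ∈ Finset.Icc 1 τ, avgWeight τ s * f (z s) := by
  rw [weightedAvg_eq]
  exact hf.map_sum_le (fun s hs => avgWeight_nonneg (by omega) hs) (sum_avgWeight hτ)
    fun _ _ => Set.mem_univ _

lemma norm_weightedAvg_le {z : ℕ → EuclideanSpace ℝ (Fin d)} {D : ℝ} {τ : ℕ} (hτ : 2 ≤ τ)
    (hz : ∀ s ≥ 1, ‖z s‖ ≤ D) : ‖weightedAvg z τ‖ ≤ D := by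
  refine (map_weightedAvg_le convexOn_univ_norm z hτ).trans ?_
  calc ∑ s ∈ Finset.Icc 1 τ, avgWeight τ s * ‖z s‖ ≤ ∑ s ∈ Finset.Icc 1 τ, avgWeight τ s * D :=
        Finset.sum_le_sum fun s hs => mul_le_mul_of_nonneg_left (hz s (Finset.mem_Icc.1 hs).1)
          (avgWeight_nonneg (by omega) hs)
    _ = D := by rw [← Finset.sum_mul, sum_avgWeight hτ, one_mul]

/-- Convexity passes from the iterates to the weighted averages. -/
lemma error_weightedAvg_le {f : Fin n → EuclideanSpace ℝ (Fin d) → ℝ} {μ : Fin n → ℝ}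
    (hμ : ∀ j, 0 < μ j) (hf : ∀ j, ConvexOn ℝ Set.univ (f j)) (zs : EuclideanSpace ℝ (Fin d))
    (z : ℕ → Fin n → EuclideanSpace ℝ (Fin d)) (i : Fin n) {T : ℕ} (hT : 1 ≤ T) :
    ∑ j, f j (weightedAvg (fun s => z s i) (T + 1)) - ∑ j, f j zs
        + ∑ j, μ j * ‖weightedAvg (fun s => z s j) (T + 1) - zs‖ ^ 2
      ≤ 2 / ((T + 1 : ℕ) * (T : ℝ)) * ∑ t ∈ Finset.Icc 1 T, (t : ℝ) *
        (∑ j, f j (z (t + 1) i) - ∑ j, f j zs + ∑ j, μ j * ‖z (t + 1) j - zs‖ ^ 2) := by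
  have hτ : 2 ≤ T + 1 := by omega
  have h1 : ∀ j, f j (weightedAvg (fun s => z s i) (T + 1))
      ≤ ∑ s ∈ Finset.Icc 1 (T + 1), avgWeight (T + 1) s * f j (z s i) :=
    fun j => map_weightedAvg_le (hf j) _ hτ
  have hsq : ConvexOn ℝ Set.univ fun u : EuclideanSpace ℝ (Fin d) => ‖u - zs‖ ^ 2 := by
    have h := ((convexOn_univ_norm (E := EuclideanSpace ℝ (Fin d))).translate_left (-zs)).pow
      (fun _ _ => norm_nonneg _) 2
    have e : (fun u : EuclideanSpace ℝ (Fin d) => ‖u - zs‖ ^ 2) = (fun u => ‖u + -zs‖) ^ 2 := by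
      ext u; rw [sub_eq_add_neg]; rfl
    rw [e]
    simpa [Function.comp_def] using h
  have h2 : ∀ j, ‖weightedAvg (fun s => z s j) (T + 1) - zs‖ ^ 2
      ≤ ∑ s ∈ Finset.Icc 1 (T + 1), avgWeight (T + 1) s * ‖z s j - zs‖ ^ 2 :=
    fun j => map_weightedAvg_le hsq _ hτ
  have h3 : ∑ j, f j (weightedAvg (fun s => z s i) (T + 1)) - ∑ j, f j zs
        + ∑ j, μ j * ‖weightedAvg (fun s => z s j) (T + 1) - zs‖ ^ 2
      ≤ ∑ s ∈ Finset.Icc 1 (T + 1), avgWeight (T + 1) s *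
        (∑ j, f j (z s i) - ∑ j, f j zs + ∑ j, μ j * ‖z s j - zs‖ ^ 2) := by
    have e1 := Finset.sum_le_sum fun j (_ : j ∈ Finset.univ) => h1 j
    have e2 := Finset.sum_le_sum fun j (_ : j ∈ Finset.univ) =>
      mul_le_mul_of_nonneg_left (h2 j) (hμ j).le
    rw [Finset.sum_comm] at e1
    simp only [Finset.mul_sum] at e2
    rw [Finset.sum_comm] at e2
    simp only [mul_add, mul_sub, Finset.sum_add_distrib, Finset.sum_sub_distrib]
    rw [← Finset.sum_mul _ _ (∑ j, f j zs), sum_avgWeight hτ, one_mul]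
    simp only [Finset.mul_sum]
    have e3 : ∀ (s : ℕ) (j : Fin n), avgWeight (T + 1) s * (μ j * ‖z s j - zs‖ ^ 2)
        = μ j * (avgWeight (T + 1) s * ‖z s j - zs‖ ^ 2) := fun s j => by ring
    simp only [e3]
    linarith
  refine h3.trans_eq ?_
  rw [← sum_Icc_sub_one_mul (fun s => ∑ j, f j (z s i) - ∑ j, f j zs
    + ∑ j, μ j * ‖z s j - zs‖ ^ 2), Finset.mul_sum]
  refine Finset.sum_congr rfl fun s _ => ?_
  rw [avgWeight, ← mul_assoc]
  congr 2
  push_cast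
  rw [inv_div]
  ring

end WeightedAverage

/-! ### The noise in expectation -/

section Noise

variable {n d : ℕ} {Ω Ξ : Type*}

/-- The iterates up to time `T` are measurable with respect to any `σ`-algebra that makes the
samples up to time `T` measurable. -/
lemma measurable_pushX {_ : MeasurableSpace Ω} [MeasurableSpace Ξ] (G : ℕ → Digraph (Fin n))
    (α : ℕ → ℝ) {sg : Fin n → EuclideanSpace ℝ (Fin d) → EuclideanSpace ℝ (Fin d)}
    {N : Fin n → EuclideanSpace ℝ (Fin d) → Ξ → EuclideanSpace ℝ (Fin d)}
    {ξ : Fin n → ℕ → Ω → Ξ} (x0 : Fin n → EuclideanSpace ℝ (Fin d))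
    (hsg : ∀ i, Measurable (sg i)) (hN : ∀ i, Measurable (Function.uncurry (N i))) {T : ℕ}
    (hξ : ∀ i, ∀ s ≤ T, Measurable (ξ i s)) : ∀ t ≤ T, ∀ i,
      Measurable fun ω => pushX G α (noisyOracle sg N ξ ω) x0 t i := by
  intro t
  induction t with
  | zero => intro _ i; exact measurable_const
  | succ t ih =>
    intro ht i
    have hmix : Measurable fun ω => pushMix (G t) (pushX G α (noisyOracle sg N ξ ω) x0 t) i :=
      Finset.measurable_sum _ fun j _ => (ih (by omega) j).fun_const_smul _
    refine hmix.sub (Measurable.fun_const_smul ?_ _)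
    have hz := hmix.fun_const_smul (pushY G (t + 1) i)⁻¹
    exact ((hsg i).comp hz).add ((hN i).comp (hz.prodMk (hξ i (t + 1) ht)))

lemma measurable_pushZ_succ {_ : MeasurableSpace Ω} [MeasurableSpace Ξ] (G : ℕ → Digraph (Fin n))
    (α : ℕ → ℝ) {sg : Fin n → EuclideanSpace ℝ (Fin d) → EuclideanSpace ℝ (Fin d)}
    {N : Fin n → EuclideanSpace ℝ (Fin d) → Ξ → EuclideanSpace ℝ (Fin d)}
    {ξ : Fin n → ℕ → Ω → Ξ} (x0 : Fin n → EuclideanSpace ℝ (Fin d))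
    (hsg : ∀ i, Measurable (sg i)) (hN : ∀ i, Measurable (Function.uncurry (N i))) {t : ℕ}
    (hξ : ∀ i, ∀ s ≤ t, Measurable (ξ i s)) (i : Fin n) :
    Measurable fun ω => pushZ G α (noisyOracle sg N ξ ω) x0 (t + 1) i :=
  Measurable.fun_const_smul (Finset.measurable_sum _ fun j _ =>
    (measurable_pushX G α x0 hsg hN hξ t le_rfl j).fun_const_smul _) _

lemma measurable_nodeMean_pushX {_ : MeasurableSpace Ω} [MeasurableSpace Ξ]
    (G : ℕ → Digraph (Fin n)) (α : ℕ → ℝ)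
    {sg : Fin n → EuclideanSpace ℝ (Fin d) → EuclideanSpace ℝ (Fin d)}
    {N : Fin n → EuclideanSpace ℝ (Fin d) → Ξ → EuclideanSpace ℝ (Fin d)}
    {ξ : Fin n → ℕ → Ω → Ξ} (x0 : Fin n → EuclideanSpace ℝ (Fin d))
    (hsg : ∀ i, Measurable (sg i)) (hN : ∀ i, Measurable (Function.uncurry (N i))) {t : ℕ}
    (hξ : ∀ i, ∀ s ≤ t, Measurable (ξ i s)) :
    Measurable fun ω => nodeMean (pushX G α (noisyOracle sg N ξ ω) x0 t) :=
  Measurable.fun_const_smul (Finset.measurable_sum _ fun j _ =>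
    measurable_pushX G α x0 hsg hN hξ t le_rfl j) _

/-- The vector against which the noise `v j` of node `j` enters `noiseTerm`, apart from its own
square; it does not involve `v j`. -/
noncomputable def noiseCoeff (a : ℝ) (w : EuclideanSpace ℝ (Fin d))
    (g v : Fin n → EuclideanSpace ℝ (Fin d)) (j : Fin n) : EuclideanSpace ℝ (Fin d) :=
  -(2 * a) • w + a ^ 2 • ((2 : ℝ) • ∑ l, g l + ∑ l ∈ Finset.univ.erase j, v l)

lemma measurable_noiseCoeff {m : MeasurableSpace Ω} (a : ℝ) {w : Ω → EuclideanSpace ℝ (Fin d)}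
    {g v : Ω → Fin n → EuclideanSpace ℝ (Fin d)} (hw : Measurable w)
    (hg : ∀ j, Measurable fun ω => g ω j) (j : Fin n)
    (hv : ∀ l ≠ j, Measurable fun ω => v ω l) :
    Measurable fun ω => noiseCoeff a (w ω) (g ω) (v ω) j := by
  have h1 : Measurable fun ω => ∑ l, g ω l := Finset.measurable_sum _ fun l _ => hg l
  have h2 : Measurable fun ω => ∑ l ∈ Finset.univ.erase j, v ω l :=
    Finset.measurable_sum _ fun l hl => hv l (Finset.ne_of_mem_erase hl)
  unfold noiseCoeff
  exact (hw.fun_const_smul _).add (((h1.fun_const_smul _).add h2).fun_const_smul _)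

variable [MeasurableSpace Ω] [MeasurableSpace Ξ] {P : Measure Ω}

/-- Functions of all samples but one are independent of that sample. -/
lemma indepFun_of_measurable_iSup_compl {ι β : Type*} [MeasurableSpace β] {ζ : ι → Ω → Ξ}
    (hζ : ∀ q, Measurable (ζ q)) (hind : iIndepFun ζ P) (q : ι) {f : Ω → β}
    (hf : Measurable[⨆ r ∈ ({q}ᶜ : Set ι), MeasurableSpace.comap (ζ r) inferInstance] f) :
    IndepFun f (ζ q) P := by
  have h := indep_iSup_of_disjoint (fun r => (hζ r).comap_le) hind.iIndep
    (disjoint_compl_left (a := ({q} : Set ι)))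
  rw [iSup_singleton] at h
  exact indep_of_indep_of_le_left h hf.comap_le

variable [IsProbabilityMeasure P]

/-- A centred noise, evaluated at a point `Z` and a sample that are independent, is orthogonal to
every `Y` for which the sample is independent of the pair of `Y` and `Z`. -/
lemma integral_inner_noise_eq_zero {Y Z : Ω → EuclideanSpace ℝ (Fin d)} {η : Ω → Ξ}
    (hY : Measurable Y) (hZ : Measurable Z) (hη : Measurable η)
    (hind : IndepFun (fun ω => (Y ω, Z ω)) η P)
    {N : EuclideanSpace ℝ (Fin d) → Ξ → EuclideanSpace ℝ (Fin d)}
    (hN : Measurable (Function.uncurry N)) (h0 : ∀ u, ∫ ω, N u (η ω) ∂P = 0) {c : ℝ}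
    (hc : ∀ᵐ ω ∂P, ∀ u, ‖N u (η ω)‖ ≤ c)
    (hint : Integrable (fun ω => inner ℝ (Y ω) (N (Z ω) (η ω))) P) :
    ∫ ω, inner ℝ (Y ω) (N (Z ω) (η ω)) ∂P = 0 := by
  set φ : (EuclideanSpace ℝ (Fin d) × EuclideanSpace ℝ (Fin d)) × Ξ → ℝ :=
    fun q => inner ℝ q.1.1 (N q.1.2 q.2) with hφ
  have hφm : Measurable φ :=
    measurable_fst.fst.inner (hN.comp (measurable_fst.snd.prodMk measurable_snd))
  have hYZ : Measurable fun ω => (Y ω, Z ω) := hY.prodMk hZ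
  have hprod := (indepFun_iff_map_prod_eq_prod_map_map hYZ.aemeasurable hη.aemeasurable).1 hind
  have hpm : Measurable fun ω => ((Y ω, Z ω), η ω) := hYZ.prodMk hη
  have hi : Integrable φ ((P.map fun ω => (Y ω, Z ω)).prod (P.map η)) := by
    rw [← hprod]
    exact (integrable_map_measure hφm.aestronglyMeasurable hpm.aemeasurable).2 hint
  have e : ∫ ω, inner ℝ (Y ω) (N (Z ω) (η ω)) ∂P
      = ∫ q, φ q ∂(P.map fun ω => ((Y ω, Z ω), η ω)) :=
    (integral_map hpm.aemeasurable hφm.aestronglyMeasurable).symm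
  have : IsProbabilityMeasure (P.map η) := Measure.isProbabilityMeasure_map hη.aemeasurable
  have : IsProbabilityMeasure (P.map fun ω => (Y ω, Z ω)) :=
    Measure.isProbabilityMeasure_map hYZ.aemeasurable
  rw [e, hprod, integral_prod φ hi]
  refine (integral_congr_ae (Filter.Eventually.of_forall fun q => ?_)).trans
    (integral_zero _ _)
  have hNq : Measurable (N q.2) := hN.comp (measurable_const.prodMk measurable_id)
  have hintq : Integrable (N q.2) (P.map η) := by
    rw [integrable_map_measure hNq.aestronglyMeasurable hη.aemeasurable]
    refine Integrable.of_bound (hNq.comp hη).aestronglyMeasurable c ?_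
    filter_upwards [hc] with ω hω using hω _
  change ∫ x, inner ℝ q.1 (N q.2 x) ∂(P.map η) = 0
  rw [integral_inner hintq, integral_map hη.aemeasurable hNq.aestronglyMeasurable, h0,
    inner_zero_right]

lemma noiseTerm_eq (a : ℝ) (w : EuclideanSpace ℝ (Fin d))
    (g v : Fin n → EuclideanSpace ℝ (Fin d)) :
    noiseTerm a w g v
      = ∑ j, inner ℝ (noiseCoeff a w g v j) (v j) + a ^ 2 * ∑ j, ‖v j‖ ^ 2 := by
  have h1 : ‖∑ j, v j‖ ^ 2
      = ∑ j, inner ℝ (∑ l ∈ Finset.univ.erase j, v l) (v j) + ∑ j, ‖v j‖ ^ 2 := by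
    rw [← real_inner_self_eq_norm_sq, inner_sum, ← Finset.sum_add_distrib]
    refine Finset.sum_congr rfl fun j _ => ?_
    rw [← real_inner_self_eq_norm_sq (v j), ← inner_add_left,
      Finset.sum_erase_add _ _ (Finset.mem_univ j)]
  simp only [noiseTerm, noiseCoeff, inner_add_left, inner_smul_left, Finset.sum_add_distrib,
    ← Finset.mul_sum, ← inner_sum, h1, RCLike.conj_to_real, real_inner_comm w]
  ring

lemma norm_noiseCoeff_le {a : ℝ} {w : EuclideanSpace ℝ (Fin d)}
    {g v : Fin n → EuclideanSpace ℝ (Fin d)} {W : ℝ} {L c : Fin n → ℝ} (ha : 0 ≤ a)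
    (hw : ‖w‖ ≤ W) (hg : ∀ j, ‖g j‖ ≤ L j) (hv : ∀ j, ‖v j‖ ≤ c j) (j : Fin n) :
    ‖noiseCoeff a w g v j‖
      ≤ 2 * a * W + a ^ 2 * (2 * ∑ l, L l + ∑ l ∈ Finset.univ.erase j, c l) := by
  rw [noiseCoeff]
  refine (norm_add_le _ _).trans (add_le_add ?_ ?_)
  · rw [norm_smul, norm_neg, Real.norm_of_nonneg (by positivity)]
    gcongr
  · rw [norm_smul, Real.norm_of_nonneg (by positivity)]
    gcongr
    refine (norm_add_le _ _).trans (add_le_add ?_ (norm_sum_le_of_le _ fun l _ => hv l))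
    rw [norm_smul, Real.norm_of_nonneg (by norm_num)]
    gcongr
    exact norm_sum_le_of_le _ fun l _ => hg l

/-- In expectation only the squares of the noise vectors remain: the noise of each node is
orthogonal to the past and to the noise of the other nodes. -/
lemma integral_noiseTerm_le {a W : ℝ} (ha : 0 ≤ a) {L c : Fin n → ℝ}
    {w : Ω → EuclideanSpace ℝ (Fin d)} {g z : Fin n → Ω → EuclideanSpace ℝ (Fin d)}
    {η : Fin n → Ω → Ξ} {N : Fin n → EuclideanSpace ℝ (Fin d) → Ξ → EuclideanSpace ℝ (Fin d)}
    (hwm : Measurable w) (hgm : ∀ j, Measurable (g j)) (hzm : ∀ j, Measurable (z j))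
    (hηm : ∀ j, Measurable (η j)) (hN : ∀ j, Measurable (Function.uncurry (N j)))
    (hw : ∀ᵐ ω ∂P, ‖w ω‖ ≤ W) (hg : ∀ᵐ ω ∂P, ∀ j, ‖g j ω‖ ≤ L j)
    (h0 : ∀ j u, ∫ ω, N j u (η j ω) ∂P = 0) (hc : ∀ᵐ ω ∂P, ∀ j u, ‖N j u (η j ω)‖ ≤ c j)
    (hind : ∀ j, IndepFun (fun ω => (noiseCoeff a (w ω) (fun l => g l ω)
      (fun l => N l (z l ω) (η l ω)) j, z j ω)) (η j) P) :
    Integrable (fun ω => noiseTerm a (w ω) (fun j => g j ω)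
        (fun j => N j (z j ω) (η j ω))) P ∧
      ∫ ω, noiseTerm a (w ω) (fun j => g j ω) (fun j => N j (z j ω) (η j ω)) ∂P
        ≤ a ^ 2 * ∑ j, c j ^ 2 := by
  set v : Ω → Fin n → EuclideanSpace ℝ (Fin d) := fun ω j => N j (z j ω) (η j ω) with hv
  set Y : Fin n → Ω → EuclideanSpace ℝ (Fin d) :=
    fun j ω => noiseCoeff a (w ω) (fun l => g l ω) (v ω) j with hY
  have hvm : ∀ j, Measurable fun ω => v ω j := fun j => (hN j).comp ((hzm j).prodMk (hηm j))
  have hYm : ∀ j, Measurable (Y j) := fun j =>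
    measurable_noiseCoeff a hwm hgm j fun l _ => hvm l
  have hvb : ∀ᵐ ω ∂P, ∀ j, ‖v ω j‖ ≤ c j := by
    filter_upwards [hc] with ω hω using fun j => hω j _
  have hi1 : ∀ j, Integrable (fun ω => inner ℝ (Y j ω) (v ω j)) P := by
    intro j
    refine Integrable.of_bound ((hYm j).inner (hvm j)).aestronglyMeasurable
      ((2 * a * W + a ^ 2 * (2 * ∑ l, L l + ∑ l ∈ Finset.univ.erase j, c l)) * c j) ?_
    filter_upwards [hw, hg, hvb] with ω h1 h2 h3
    have h4 := norm_noiseCoeff_le ha h1 h2 h3 j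
    exact (norm_inner_le_norm _ _).trans
      (mul_le_mul h4 (h3 j) (norm_nonneg _) ((norm_nonneg _).trans h4))
  have hsq : ∀ᵐ ω ∂P, ∀ j, ‖v ω j‖ ^ 2 ≤ c j ^ 2 := by
    filter_upwards [hvb] with ω hω using fun j => pow_le_pow_left₀ (norm_nonneg _) (hω j) 2
  have hi2 : ∀ j, Integrable (fun ω => ‖v ω j‖ ^ 2) P := by
    intro j
    refine Integrable.of_bound ((hvm j).norm.pow_const 2).aestronglyMeasurable (c j ^ 2) ?_
    filter_upwards [hsq] with ω hω
    rw [Real.norm_of_nonneg (sq_nonneg _)]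
    exact hω j
  have hi1s := integrable_finsetSum Finset.univ fun j _ => hi1 j
  have hi2s := (integrable_finsetSum Finset.univ fun j _ => hi2 j).const_mul (a ^ 2)
  simp only [noiseTerm_eq]
  refine ⟨hi1s.add hi2s, ?_⟩
  rw [integral_add hi1s hi2s, integral_finsetSum _ fun j _ => hi1 j, integral_const_mul,
    integral_finsetSum _ fun j _ => hi2 j]
  have hz0 : ∀ j, ∫ ω, inner ℝ (Y j ω) (v ω j) ∂P = 0 := fun j =>
    integral_inner_noise_eq_zero (hYm j) (hzm j) (hηm j) (hind j) (hN j) (h0 j)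
      (by filter_upwards [hc] with ω hω using hω j) (hi1 j)
  rw [Finset.sum_eq_zero fun j _ => hz0 j, zero_add]
  refine mul_le_mul_of_nonneg_left (Finset.sum_le_sum fun j _ => ?_) (sq_nonneg a)
  calc ∫ ω, ‖v ω j‖ ^ 2 ∂P ≤ ∫ _, c j ^ 2 ∂P := by
        refine integral_mono_ae (hi2 j) (integrable_const _) ?_
        filter_upwards [hsq] with ω hω using hω j
    _ = c j ^ 2 := by simp

end Noise

/-! ### The expected error -/

section ExpectedError

variable {n d : ℕ}

lemma sum_Icc_one_div_le (T : ℕ) :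
    ∑ s ∈ Finset.Icc 1 T, 1 / (s : ℝ) ≤ 1 + Real.log T := by
  have h := harmonic_le_one_add_log T
  rw [harmonic_eq_sum_Icc] at h
  push_cast at h
  simpa only [one_div] using h

/-- The arithmetic behind the final constants, with `Q = (∑ Lⱼ)²` and `C = ∑ cⱼ²`. The constant `80`
leaves room for the term with `Q`, since `Λ = ∑ Lⱼ ≤ n B̂`; the term with `C` needs `n ≥ 2`. -/
lemma weighted_error_le {T : ℕ} (hT : 1 ≤ T) {ν p δ lam S Λ Bh C : ℝ} (hν : 2 ≤ ν) (hp : 0 < p)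
    (hδ : 0 < δ) (hδ1 : δ ≤ 1) (hlam : 0 ≤ lam) (hlam1 : lam < 1) (hS : 0 ≤ S) (hΛ : 0 ≤ Λ)
    (hΛB : Λ ≤ ν * Bh) (hC : 0 ≤ C) :
    2 / ((T + 1 : ℕ) * (T : ℝ)) * ∑ t ∈ Finset.Icc 1 T,
        ((t : ℝ) * (5 * Λ * (4 / δ * discountedSum lam S (fun s => p / (s : ℝ) * (ν * Bh)) t))
          + p / ν * (Λ ^ 2 + C) * (t / (t + 1)))
      ≤ 80 * Λ / ((T + 1 : ℕ) * δ) * (lam / (1 - lam)) * S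
        + 80 * p * Λ * ν * Bh / ((T + 1 : ℕ) * δ * (1 - lam)) * (1 + Real.log T)
        + p / (T + 1 : ℕ) * C := by
  have hT0 : (0 : ℝ) < T := by exact_mod_cast hT
  have hT1 : (1 : ℝ) ≤ T := by exact_mod_cast hT
  have hlog : 0 ≤ Real.log T := Real.log_nonneg hT1
  have hl : 0 < 1 - lam := by linarith
  have hνB : 0 ≤ ν * Bh := hΛ.trans hΛB
  set b : ℕ → ℝ := fun s => p / (s : ℝ) * (ν * Bh) with hb
  have hb0 : ∀ s, 0 ≤ b s := fun s => mul_nonneg (by positivity) hνB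
  have hd0 := discountedSum_nonneg hlam hS hb0
  have hden : 0 < ((T + 1 : ℕ) : ℝ) := by positivity
  set τ : ℝ := ((T + 1 : ℕ) : ℝ) with hτ
  -- bound the weights `t` by `T` and the quotients `t / (t + 1)` by `1`
  have h1 : ∑ t ∈ Finset.Icc 1 T, ((t : ℝ) * (5 * Λ * (4 / δ * discountedSum lam S b t))
        + p / ν * (Λ ^ 2 + C) * (t / (t + 1)))
      ≤ T * (20 * Λ / δ * ∑ t ∈ Finset.Icc 1 T, discountedSum lam S b t
          + p / ν * (Λ ^ 2 + C)) := by
    have h2 : ∀ t ∈ Finset.Icc 1 T, ((t : ℝ) * (5 * Λ * (4 / δ * discountedSum lam S b t))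
        + p / ν * (Λ ^ 2 + C) * (t / (t + 1)))
        ≤ T * (20 * Λ / δ * discountedSum lam S b t) + p / ν * (Λ ^ 2 + C) := by
      intro t ht
      have ht1 : (t : ℝ) ≤ T := by exact_mod_cast (Finset.mem_Icc.1 ht).2
      have h3 : (t : ℝ) / (t + 1) ≤ 1 := by
        rw [div_le_one (by positivity)]; linarith
      have h4 : 0 ≤ 5 * Λ * (4 / δ * discountedSum lam S b t) :=
        mul_nonneg (by positivity) (mul_nonneg (by positivity) (hd0 t))
      have h5 : 0 ≤ p / ν * (Λ ^ 2 + C) := by positivity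
      have h6 := mul_le_mul_of_nonneg_right ht1 h4
      have h7 := mul_le_mul_of_nonneg_left h3 h5
      have h8 : 20 * Λ / δ * discountedSum lam S b t
          = 5 * Λ * (4 / δ * discountedSum lam S b t) := by ring
      rw [h8]
      linarith
    refine (Finset.sum_le_sum h2).trans_eq ?_
    rw [Finset.sum_add_distrib, ← Finset.mul_sum, ← Finset.mul_sum, Finset.sum_const,
      Nat.card_Icc, nsmul_eq_mul, Nat.add_sub_cancel]
    ring
  have h2 : ∑ t ∈ Finset.Icc 1 T, discountedSum lam S b t
      ≤ lam / (1 - lam) * S + 1 / (1 - lam) * (p * (ν * Bh) * (1 + Real.log T)) := by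
    refine (sum_discountedSum_le hlam hlam1 hS hb0 T).trans ?_
    rw [mul_add]
    gcongr
    · have e : ∑ s ∈ Finset.Icc 1 T, b s = p * (ν * Bh) * ∑ s ∈ Finset.Icc 1 T, 1 / (s : ℝ) := by
        rw [Finset.mul_sum]
        exact Finset.sum_congr rfl fun s _ => by simp only [hb]; ring
      rw [e]
      exact mul_le_mul_of_nonneg_left (sum_Icc_one_div_le T) (mul_nonneg hp.le hνB)
  have hpν : p / ν ≤ p / 2 := by gcongr
  have h3 : p / ν * (Λ ^ 2 + C) ≤ p / 2 * (Λ * (ν * Bh) + C) := by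
    have : Λ ^ 2 ≤ Λ * (ν * Bh) := by rw [sq]; gcongr
    have h0 : 0 ≤ Λ ^ 2 + C := by positivity
    exact mul_le_mul hpν (by linarith) h0 (by positivity)
  -- the term with `Λ²` fits into the second term: `1 ≤ (1 + log T) / (δ (1 - lam))`
  have h4 : p * (Λ * (ν * Bh)) ≤ p * Λ * (ν * Bh) / (δ * (1 - lam)) * (1 + Real.log T) := by
    have h5 : δ * (1 - lam) ≤ 1 := mul_le_one₀ hδ1 hl.le (by linarith)
    have h6 : 0 ≤ p * Λ * (ν * Bh) := by positivity
    calc p * (Λ * (ν * Bh)) = p * Λ * (ν * Bh) / 1 * 1 := by ring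
      _ ≤ p * Λ * (ν * Bh) / (δ * (1 - lam)) * (1 + Real.log T) := by
        refine mul_le_mul ?_ (by linarith) zero_le_one (by positivity)
        exact div_le_div_of_nonneg_left h6 (by positivity) h5
  have hX : 0 ≤ lam / (1 - lam) * S := by positivity
  calc 2 / (τ * (T : ℝ)) * ∑ t ∈ Finset.Icc 1 T,
        ((t : ℝ) * (5 * Λ * (4 / δ * discountedSum lam S b t))
          + p / ν * (Λ ^ 2 + C) * (t / (t + 1)))
      ≤ 2 / (τ * (T : ℝ)) * (T * (20 * Λ / δ * (lam / (1 - lam) * S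
          + 1 / (1 - lam) * (p * (ν * Bh) * (1 + Real.log T)))
          + p / 2 * (Λ * (ν * Bh) + C))) := by
        refine mul_le_mul_of_nonneg_left (h1.trans ?_) (by positivity)
        gcongr
    _ = 1 / τ * (40 * (Λ / δ * (lam / (1 - lam) * S))
          + 40 * (p * Λ * (ν * Bh) / (δ * (1 - lam)) * (1 + Real.log T))
          + p * (Λ * (ν * Bh)) + p * C) := by
        field_simp
        ring
    _ ≤ 1 / τ * (80 * (Λ / δ * (lam / (1 - lam) * S))
          + 80 * (p * Λ * (ν * Bh) / (δ * (1 - lam)) * (1 + Real.log T)) + p * C) := by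
        refine mul_le_mul_of_nonneg_left ?_ (by positivity)
        have h7 : 0 ≤ Λ / δ * (lam / (1 - lam) * S) := by positivity
        have h8 : 0 ≤ p * Λ * (ν * Bh) / (δ * (1 - lam)) * (1 + Real.log T) := by positivity
        linarith
    _ = _ := by
        field_simp

/-- The error along one outcome: a deterministic part, from the disagreement and the squared
subgradients, and a weighted sum of the noise terms. Here `v j t u` is the noise of node `j` at
time `t` and the point `u`. -/
lemma error_weightedAvg_pushZ_le {G : ℕ → Digraph (Fin n)} (hn : 0 < n) {δ lam : ℝ} (hδ : 0 < δ)
    (hlam : 0 ≤ lam) (hy : ∀ t i, δ ≤ pushY G t i)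
    (hcon : ∀ s k (v : Fin n → ℝ), ∑ j, v j = 0 → ∀ i,
      |(pushProd G s k).mulVec v i| ≤ 2 * lam ^ k * ∑ j, |v j|)
    {f : Fin n → EuclideanSpace ℝ (Fin d) → ℝ} {μ : Fin n → ℝ}
    {sg : Fin n → EuclideanSpace ℝ (Fin d) → EuclideanSpace ℝ (Fin d)}
    {v : Fin n → ℕ → EuclideanSpace ℝ (Fin d) → EuclideanSpace ℝ (Fin d)} {c : Fin n → ℝ}
    {x0 : Fin n → EuclideanSpace ℝ (Fin d)} {p D Bh : ℝ} (hp : 0 < p)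
    (hμ : ∀ j, 0 < μ j) (hf : ∀ j, StrongConvexOn Set.univ (μ j) (f j))
    (hsg : ∀ j u, IsSubgradient (f j) u (sg j u)) (hpμ : 4 ≤ p * ((∑ i, μ i) / n))
    {zs : EuclideanSpace ℝ (Fin d)} (hzs : ∀ u, ∑ j, f j zs ≤ ∑ j, f j u)
    (hv : ∀ j, ∀ t ≥ 1, ∀ u, ‖v j t u‖ ≤ c j)
    (hBh : ∀ j, √(d : ℝ) * (maxSubgradNorm (f j) D + c j) ≤ Bh)
    {z : ℕ → Fin n → EuclideanSpace ℝ (Fin d)}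
    (hz : z = pushZ G (fun s => p / (s : ℝ)) (fun j t u => sg j u + v j t u) x0)
    {x : ℕ → EuclideanSpace ℝ (Fin d)}
    (hx : ∀ t, x t =
      nodeMean (pushX G (fun s => p / (s : ℝ)) (fun j t u => sg j u + v j t u) x0 t))
    (hD : ∀ i, ∀ t ≥ 1, ‖z t i‖ ≤ D) (i : Fin n) {T : ℕ} (hT : 1 ≤ T) :
    ∑ j, f j (weightedAvg (fun s => z s i) (T + 1)) - ∑ j, f j zs
        + ∑ j, μ j * ‖weightedAvg (fun s => z s j) (T + 1) - zs‖ ^ 2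
      ≤ 2 / ((T + 1 : ℕ) * (T : ℝ)) * ∑ t ∈ Finset.Icc 1 T,
        ((t : ℝ) * (5 * (∑ j, maxSubgradNorm (f j) D) * (4 / δ * discountedSum lam
            (∑ j, l1Norm (x0 j)) (fun s => p / (s : ℝ) * (n * Bh)) t))
          + p / n * (∑ j, maxSubgradNorm (f j) D) ^ 2 * (t / (t + 1))
          + n / p * (t * (t + 1)) * noiseTerm (p / n / (t + 1)) (x t - zs)
            (fun j => sg j (z (t + 1) j)) (fun j => v j (t + 1) (z (t + 1) j))) := by
  subst hz
  set g : Fin n → ℕ → EuclideanSpace ℝ (Fin d) → EuclideanSpace ℝ (Fin d) :=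
    fun j t u => sg j u + v j t u with hg
  set α : ℕ → ℝ := fun s => p / (s : ℝ) with hα
  set z := pushZ G α g x0 with hz
  have hn0 : (0 : ℝ) < n := by exact_mod_cast hn
  have hypos : ∀ t i, 0 < pushY G t i := fun t i => hδ.trans_le (hy t i)
  set ε : ℕ → ℝ := fun t => 4 / δ * discountedSum lam (∑ j, l1Norm (x0 j))
    (fun s => p / (s : ℝ) * (n * Bh)) t with hε
  have hsgL : ∀ j u, ‖u‖ ≤ D → ‖sg j u‖ ≤ maxSubgradNorm (f j) D := fun j u hu =>
    (hsg j u).norm_le ((hf j).convexOn_univ (hμ j).le) hu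
  have hdis : ∀ t j, ‖z (t + 1) j - x t‖ ≤ ε t := by
    intro t j
    rw [hx]
    refine norm_pushZ_sub_nodeMean_le α g x0 hn hδ hlam hy hcon t j fun s hs => ?_
    have hs1 := (Finset.mem_Icc.1 hs).1
    have hα0 : 0 ≤ α s := by positivity
    rw [abs_of_nonneg hα0]
    refine mul_le_mul_of_nonneg_left ?_ hα0
    have h1 : ∀ l, l1Norm (g l s (z s l)) ≤ Bh := fun l => by
      refine (l1Norm_le _).trans (le_trans ?_ (hBh l))
      exact mul_le_mul_of_nonneg_left ((norm_add_le _ _).trans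
        (add_le_add (hsgL l _ (hD l s hs1)) (hv l s hs1 _))) (Real.sqrt_nonneg _)
    exact (Finset.sum_le_sum fun l _ => h1 l).trans_eq (by simp)
  have hxD : ∀ t, ‖x t‖ ≤ D := fun t => by
    rw [hx]; exact norm_nodeMean_pushX_le α g x0 hn hypos fun i => hD i (t + 1) (by omega)
  have hstep : ∀ t, ‖x (t + 1) - zs‖ ^ 2
      ≤ (1 - p / n / (t + 1) * (∑ j, μ j) / 2) * ‖x t - zs‖ ^ 2
        - p / n / (t + 1) * (∑ j, f j (z (t + 1) i) - ∑ j, f j zs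
          + ∑ j, μ j * ‖z (t + 1) j - zs‖ ^ 2)
        + p / n / (t + 1) * (5 * (∑ j, maxSubgradNorm (f j) D) * ε t)
        + (p / n / (t + 1)) ^ 2 * (∑ j, maxSubgradNorm (f j) D) ^ 2
        + noiseTerm (p / n / (t + 1)) (x t - zs) (fun j => sg j (z (t + 1) j))
          (fun j => v j (t + 1) (z (t + 1) j)) := by
    intro t
    have h1 : x (t + 1) = x t - (p / n / (t + 1)) •
        ∑ j, (sg j (z (t + 1) j) + v j (t + 1) (z (t + 1) j)) := by
      rw [hx, hx, nodeMean_pushX_succ]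
      simp only [hα, hg, hz]
      push_cast
      rw [div_right_comm]
    rw [h1]
    exact norm_step_sub_sq_le hμ hf hsg hzs (hxD t) (fun j => hD j (t + 1) (by omega)) (hdis t)
      (by positivity) i
  have hsum := sum_mul_le_of_step (U := fun t => ‖x t - zs‖ ^ 2)
    (R := fun t => ∑ j, f j (z t i) - ∑ j, f j zs + ∑ j, μ j * ‖z t j - zs‖ ^ 2)
    (fun t => sq_nonneg _) (by rw [div_mul_eq_mul_div, ← mul_div_assoc] at *; exact hpμ) hstep T
  refine (error_weightedAvg_le hμ (fun j => (hf j).convexOn_univ (hμ j).le) zs z i hT).trans ?_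
  refine mul_le_mul_of_nonneg_left ?_ (by positivity)
  have hnp : 0 < n / p := by positivity
  have h2 := mul_le_mul_of_nonneg_left hsum hnp.le
  rw [← mul_assoc, show (n : ℝ) / p * (p / n) = 1 by field_simp, one_mul, Finset.mul_sum] at h2
  refine h2.trans_eq (Finset.sum_congr rfl fun t _ => ?_)
  have e : (n : ℝ) / p * (p / n) = 1 := by field_simp
  change _ = (t : ℝ) * (5 * (∑ j, maxSubgradNorm (f j) D) * ε t)
    + p / n * (∑ j, maxSubgradNorm (f j) D) ^ 2 * (t / (t + 1)) + _
  linear_combination ((t : ℝ) * (5 * (∑ j, maxSubgradNorm (f j) D) * ε t)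
    + p / n * (∑ j, maxSubgradNorm (f j) D) ^ 2 * (t / (t + 1))) * e

variable {Ω Ξ : Type*} [MeasurableSpace Ω] [MeasurableSpace Ξ]

/-- The noise terms along the method: at every step, the noise of a node is independent of the
past and of the noise of the other nodes. -/
lemma integral_noiseTerm_push_le {G : ℕ → Digraph (Fin n)} {P : Measure Ω}
    [IsProbabilityMeasure P]
    {sg : Fin n → EuclideanSpace ℝ (Fin d) → EuclideanSpace ℝ (Fin d)}
    {N : Fin n → EuclideanSpace ℝ (Fin d) → Ξ → EuclideanSpace ℝ (Fin d)}
    {ξ : Fin n → ℕ → Ω → Ξ} {c L : Fin n → ℝ} {x0 : Fin n → EuclideanSpace ℝ (Fin d)}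
    {α : ℕ → ℝ} {D : ℝ} (hsgm : ∀ i, Measurable (sg i))
    (hN : ∀ i, Measurable (Function.uncurry (N i))) (hξ : ∀ i t, Measurable (ξ i t))
    (hind : iIndepFun (fun (q : Fin n × ℕ) => ξ q.1 q.2) P) {t : ℕ}
    (h0 : ∀ i, ∀ u, ∫ ω, N i u (ξ i (t + 1) ω) ∂P = 0)
    (hc : ∀ᵐ ω ∂P, ∀ i u, ‖N i u (ξ i (t + 1) ω)‖ ≤ c i)
    (hx : ∀ᵐ ω ∂P, ‖nodeMean (pushX G α (noisyOracle sg N ξ ω) x0 t)‖ ≤ D)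
    (hsg : ∀ᵐ ω ∂P, ∀ i, ‖sg i (pushZ G α (noisyOracle sg N ξ ω) x0 (t + 1) i)‖ ≤ L i)
    (zs : EuclideanSpace ℝ (Fin d)) {a : ℝ} (ha : 0 ≤ a) :
    Integrable (fun ω => noiseTerm a (nodeMean (pushX G α (noisyOracle sg N ξ ω) x0 t) - zs)
      (fun j => sg j (pushZ G α (noisyOracle sg N ξ ω) x0 (t + 1) j))
      (fun j => N j (pushZ G α (noisyOracle sg N ξ ω) x0 (t + 1) j) (ξ j (t + 1) ω))) P ∧
    ∫ ω, noiseTerm a (nodeMean (pushX G α (noisyOracle sg N ξ ω) x0 t) - zs)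
      (fun j => sg j (pushZ G α (noisyOracle sg N ξ ω) x0 (t + 1) j))
      (fun j => N j (pushZ G α (noisyOracle sg N ξ ω) x0 (t + 1) j) (ξ j (t + 1) ω)) ∂P
      ≤ a ^ 2 * ∑ j, c j ^ 2 := by
  have hzm : ∀ j, Measurable fun ω => pushZ G α (noisyOracle sg N ξ ω) x0 (t + 1) j :=
    measurable_pushZ_succ G α x0 hsgm hN fun i s _ => hξ i s
  have hxm : Measurable fun ω => nodeMean (pushX G α (noisyOracle sg N ξ ω) x0 t) :=
    measurable_nodeMean_pushX G α x0 hsgm hN fun i s _ => hξ i s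
  refine integral_noiseTerm_le (W := D + ‖zs‖) (L := L) ha (hxm.sub_const zs)
    (fun j => (hsgm j).comp (hzm j)) hzm (fun j => hξ j (t + 1)) hN ?_ hsg h0 hc fun j => ?_
  · filter_upwards [hx] with ω hω
    exact (norm_sub_le _ _).trans (by linarith)
  · refine indepFun_of_measurable_iSup_compl (fun q : Fin n × ℕ => hξ q.1 q.2) hind (j, t + 1) ?_
    set m := ⨆ r ∈ ({(j, t + 1)}ᶜ : Set (Fin n × ℕ)),
      MeasurableSpace.comap (ξ r.1 r.2) inferInstance with hm
    have hmeas : ∀ i s, (i, s) ≠ (j, t + 1) → Measurable[m] (ξ i s) := fun i s h =>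
      measurable_iff_comap_le.2 (le_iSup₂_of_le (f := fun (r : Fin n × ℕ) (_ : r ∈ _) =>
        MeasurableSpace.comap (ξ r.1 r.2) inferInstance) (i, s) h le_rfl)
    have hpast : ∀ i, ∀ s ≤ t, Measurable[m] (ξ i s) := fun i s hs =>
      hmeas i s fun h => by
        have := (Prod.mk.inj h).2
        omega
    have hzm' : ∀ j, Measurable[m] fun ω => pushZ G α (noisyOracle sg N ξ ω) x0 (t + 1) j :=
      measurable_pushZ_succ G α x0 hsgm hN hpast
    have hxm' : Measurable[m] fun ω => nodeMean (pushX G α (noisyOracle sg N ξ ω) x0 t) :=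
      measurable_nodeMean_pushX G α x0 hsgm hN hpast
    refine Measurable.prodMk (measurable_noiseCoeff a (hxm'.sub_const zs)
      (fun l => (hsgm l).comp (hzm' l)) j fun l hl => ?_) (hzm' j)
    exact (hN l).comp ((hzm' l).prodMk (hmeas l (t + 1) fun h => hl (Prod.mk.inj h).1))

/-- The error is a continuous function of measurable iterates that stay in a ball. -/
lemma integrable_error {P : Measure Ω} [IsProbabilityMeasure P]
    {f : Fin n → EuclideanSpace ℝ (Fin d) → ℝ} (hf : ∀ j, Continuous (f j)) (μ : Fin n → ℝ)
    (zs : EuclideanSpace ℝ (Fin d)) {u : Fin n → Ω → EuclideanSpace ℝ (Fin d)} {D : ℝ}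
    (hu : ∀ j, Measurable (u j)) (hD : ∀ᵐ ω ∂P, ∀ j, ‖u j ω‖ ≤ D) (i : Fin n) :
    Integrable (fun ω => ∑ j, f j (u i ω) - ∑ j, f j zs + ∑ j, μ j * ‖u j ω - zs‖ ^ 2) P := by
  have hcomp : ∀ (h : EuclideanSpace ℝ (Fin d) → ℝ), Continuous h → ∀ j,
      Integrable (fun ω => h (u j ω)) P := by
    intro h hh j
    obtain ⟨C, hC⟩ := (isCompact_closedBall (0 : EuclideanSpace ℝ (Fin d))
      D).exists_bound_of_continuousOn hh.continuousOn
    refine Integrable.of_bound (hh.measurable.comp (hu j)).aestronglyMeasurable C ?_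
    filter_upwards [hD] with ω hω
    exact hC _ (mem_closedBall_zero_iff.2 (hω j))
  exact ((integrable_finsetSum _ fun j _ => hcomp _ (hf j) i).sub (integrable_const _)).add
    (integrable_finsetSum _ fun j _ => (hcomp (fun w => ‖w - zs‖ ^ 2) (by fun_prop) j).const_mul _)

end ExpectedError

theorem theorem1
    -- the network
    (n B : ℕ) (hn : 2 ≤ n) (G : ℕ → Digraph (Fin n)) (hG : BStronglyConnected G B) :
    -- scalars that depend on the graph sequence only
    ∃ δ lam : ℝ,
      0 < δ ∧ 0 ≤ lam ∧ lam < 1 ∧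
      (0 < lam ∨ ((∀ t, IsRegularDigraph (G t)) ∧ (⨆ t, sigmaTwo (pushMatrix (G t))) = 0)) ∧
      1 / (n : ℝ) ^ (n * B) ≤ δ ∧
      lam ≤ (1 - 1 / (n : ℝ) ^ (n * B)) ^ (1 / ((n : ℝ) * (B : ℝ))) ∧
      ((∀ t, IsRegularDigraph (G t)) →
        δ = 1 ∧
        lam ≤ min ((1 - 1 / (4 * (n : ℝ) ^ 3)) ^ (1 / (B : ℝ)))
          (⨆ t, sigmaTwo (pushMatrix (G t)))) ∧
      ∀ (d : ℕ)
        -- the strongly convex objectives and the subgradients that the nodes use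
        (f : Fin n → EuclideanSpace ℝ (Fin d) → ℝ) (μ : Fin n → ℝ)
        (sg : Fin n → EuclideanSpace ℝ (Fin d) → EuclideanSpace ℝ (Fin d))
        -- the noise
        {Ω Ξ : Type*} [MeasurableSpace Ω] [MeasurableSpace Ξ]
        (P : Measure Ω) [IsProbabilityMeasure P]
        (N : Fin n → EuclideanSpace ℝ (Fin d) → Ξ → EuclideanSpace ℝ (Fin d))
        (ξ : Fin n → ℕ → Ω → Ξ) (c : Fin n → ℝ)
        -- initial points, stepsize constant, bound on the iterates
        (x0 : Fin n → EuclideanSpace ℝ (Fin d)) (p D : ℝ),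
        (∀ i, 0 < μ i) →
        (∀ i, StrongConvexOn Set.univ (μ i) (f i)) →
        (∀ i u, IsSubgradient (f i) u (sg i u)) →
        (∀ i, Measurable (sg i)) →
        (∀ i, Measurable (Function.uncurry (N i))) →
        (∀ i t, Measurable (ξ i t)) →
        iIndepFun (fun (q : Fin n × ℕ) => ξ q.1 q.2) P →
        (∀ i, ∀ t ≥ 1, ∀ u, ∫ ω, N i u (ξ i t ω) ∂P = 0) →
        (∀ i, ∀ t ≥ 1, ∀ᵐ ω ∂P, ∀ u, ‖N i u (ξ i t ω)‖ ≤ c i) →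
        4 ≤ p * ((∑ i, μ i) / n) →
        (∀ᵐ ω ∂P, ∀ i, ∀ t ≥ 1,
          ‖pushZ G (fun s => p / (s : ℝ)) (noisyOracle sg N ξ ω) x0 t i‖ ≤ D) →
        -- the unique minimizer of the sum, and the bound
        ∃ zs : EuclideanSpace ℝ (Fin d),
          (∀ v, v ≠ zs → ∑ j, f j zs < ∑ j, f j v) ∧
          ∀ (i : Fin n) (τ : ℕ), 2 ≤ τ →
            let zhat : Fin n → Ω → EuclideanSpace ℝ (Fin d) := fun j ω =>
              weightedAvg
                (fun s => pushZ G (fun s => p / (s : ℝ)) (noisyOracle sg N ξ ω) x0 s j) τ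
            let err : Ω → ℝ := fun ω =>
              ∑ j, f j (zhat i ω) - ∑ j, f j zs + ∑ j, μ j * ‖zhat j ω - zs‖ ^ 2
            let L : Fin n → ℝ := fun j => maxSubgradNorm (f j) D
            Integrable err P ∧
            ∫ ω, err ω ∂P ≤
              80 * (∑ j, L j) / (τ * δ) * (lam / (1 - lam)) * ∑ j, l1Norm (x0 j)
              + 80 * p * (∑ j, L j) * n * (⨆ j, √(d : ℝ) * (L j + c j)) / (τ * δ * (1 - lam))
                  * (1 + Real.log ((τ : ℝ) - 1))
              + p / τ * ∑ j, (L j + c j) ^ 2 := by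
  obtain ⟨δ, lam, hδ, hlam, hlam1, hlampos, hδn, hlamn, hreg, hδ1, hy, hcon⟩ :=
    exists_contraction_scalars hn hG
  refine ⟨δ, lam, hδ, hlam, hlam1, hlampos, hδn, hlamn, hreg, ?_⟩
  intro d f μ sg Ω Ξ _ _ P _ N ξ c x0 p D hμ hf hsg hsgm hN hξ hind h0 hc hpμ hD
  have hn0 : 0 < n := by omega
  have hnR : (0 : ℝ) < n := by exact_mod_cast hn0
  have : Nonempty (Fin n) := ⟨⟨0, hn0⟩⟩
  have hM : 0 < ∑ j, μ j := Finset.sum_pos (fun j _ => hμ j) Finset.univ_nonempty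
  have hp : 0 < p := by
    by_contra! h
    have : p * ((∑ i, μ i) / n) ≤ 0 := mul_nonpos_of_nonpos_of_nonneg h (by positivity)
    linarith
  -- the minimizer
  have hF := strongConvexOn_sum hf
  have hF0 : IsSubgradient (fun v => ∑ j, f j v) 0 (∑ j, sg j 0) := fun v => by
    rw [sum_inner, ← Finset.sum_add_distrib]
    exact Finset.sum_le_sum fun j _ => hsg j 0 v
  obtain ⟨zs, hzs⟩ := exists_forall_le_of_strongConvexOn hM hF hF0
  refine ⟨zs, fun v hv => ?_, ?_⟩
  · have h1 : IsSubgradient (fun v => ∑ j, f j v) zs 0 := fun v => by simpa using hzs v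
    have h2 := h1.add_sq_le hF v
    have h3 : 0 < ‖v - zs‖ := norm_pos_iff.2 (sub_ne_zero.2 hv)
    have h4 : 0 < (∑ j, μ j) / 2 * ‖v - zs‖ ^ 2 := by positivity
    rw [inner_zero_left] at h2
    linarith
  intro i τ hτ zhat err L
  obtain ⟨T, rfl⟩ : ∃ T, τ = T + 1 := ⟨τ - 1, by omega⟩
  have hT : 1 ≤ T := by omega
  -- almost sure bounds
  have hc' : ∀ᵐ ω ∂P, ∀ j, ∀ t ≥ 1, ∀ u, ‖N j u (ξ j t ω)‖ ≤ c j := by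
    rw [ae_all_iff]; intro j; rw [ae_all_iff]; intro t
    by_cases ht : t ≥ 1
    · filter_upwards [hc j t ht] with ω hω _ using hω
    · exact Filter.Eventually.of_forall fun ω h => absurd h ht
  obtain ⟨ω₀, hω₀⟩ := hc'.exists
  have hc0 : ∀ j, 0 ≤ c j := fun j => (norm_nonneg _).trans (hω₀ j 1 le_rfl 0)
  have hL0 : ∀ j, 0 ≤ L j := fun j => maxSubgradNorm_nonneg _ _
  set Bh := ⨆ j, √(d : ℝ) * (L j + c j) with hBh
  have hBhj : ∀ j, √(d : ℝ) * (L j + c j) ≤ Bh := fun j =>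
    le_ciSup (f := fun j => √(d : ℝ) * (L j + c j)) (Set.finite_range _).bddAbove j
  have hΛ : 0 ≤ ∑ j, L j := Finset.sum_nonneg fun j _ => hL0 j
  have hΛB : ∑ j, L j ≤ n * Bh := by
    have h1 : ∀ j, L j ≤ Bh := fun j => (maxSubgradNorm_le_sqrt_mul _ _).trans
      ((mul_le_mul_of_nonneg_left (by linarith [hc0 j]) (Real.sqrt_nonneg _)).trans (hBhj j))
    exact (Finset.sum_le_sum fun j _ => h1 j).trans_eq (by simp)
  -- integrability of the error
  have hzm : ∀ j, ∀ s ≥ 1, Measurable fun ω =>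
      pushZ G (fun s => p / (s : ℝ)) (noisyOracle sg N ξ ω) x0 s j := by
    intro j s hs
    obtain ⟨t, rfl⟩ := Nat.exists_eq_add_of_le' hs
    exact measurable_pushZ_succ G _ x0 hsgm hN (fun i s _ => hξ i s) j
  have hzhm : ∀ j, Measurable (zhat j) := fun j =>
    Measurable.fun_const_smul (Finset.measurable_sum _ fun s hs =>
      (hzm j s (Finset.mem_Icc.1 hs).1).fun_const_smul _) _
  have herr : Integrable err P :=
    integrable_error (fun j => ((hf j).convexOn_univ (hμ j).le).locallyLipschitz.continuous) μ zs
      hzhm (by filter_upwards [hD] with ω hω using fun j => norm_weightedAvg_le hτ (hω j)) i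
  refine ⟨herr, ?_⟩
  -- the noise in expectation
  set S : ℕ → Ω → ℝ := fun t ω => noiseTerm (p / n / (t + 1))
      (nodeMean (pushX G (fun s => p / (s : ℝ)) (noisyOracle sg N ξ ω) x0 t) - zs)
      (fun j => sg j (pushZ G (fun s => p / (s : ℝ)) (noisyOracle sg N ξ ω) x0 (t + 1) j))
      (fun j => N j (pushZ G (fun s => p / (s : ℝ)) (noisyOracle sg N ξ ω) x0 (t + 1) j)
        (ξ j (t + 1) ω)) with hSdef
  have hS : ∀ t, Integrable (S t) P ∧ ∫ ω, S t ω ∂P ≤ (p / n / (t + 1)) ^ 2 * ∑ j, c j ^ 2 := by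
    intro t
    refine integral_noiseTerm_push_le (D := D) (L := L) hsgm hN hξ hind
      (fun j => h0 j (t + 1) (by omega)) ?_ ?_ ?_ zs (by positivity)
    · filter_upwards [hc'] with ω hω using fun j => hω j (t + 1) (by omega)
    · filter_upwards [hD] with ω hω
      exact norm_nodeMean_pushX_le _ _ x0 hn0 (fun t i => hδ.trans_le (hy t i))
        fun j => hω j (t + 1) (by omega)
    · filter_upwards [hD] with ω hω
      exact fun j => (hsg j _).norm_le ((hf j).convexOn_univ (hμ j).le) (hω j (t + 1) (by omega))
  -- the bound along almost every outcome
  set K : ℕ → ℝ := fun t => (t : ℝ) * (5 * (∑ j, L j) * (4 / δ * discountedSum lam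
      (∑ j, l1Norm (x0 j)) (fun s => p / (s : ℝ) * (n * Bh)) t))
    + p / n * (∑ j, L j) ^ 2 * (t / (t + 1)) with hK
  set κ : ℝ := 2 / ((T + 1 : ℕ) * (T : ℝ)) with hκ
  have hκ0 : 0 ≤ κ := by positivity
  have hpath : ∀ᵐ ω ∂P, err ω
      ≤ κ * ∑ t ∈ Finset.Icc 1 T, (K t + n / p * (t * (t + 1)) * S t ω) := by
    filter_upwards [hD, hc'] with ω h1 h2
    exact error_weightedAvg_pushZ_le hn0 hδ hlam hy hcon hp hμ hf hsg hpμ hzs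
      (v := fun j t u => N j u (ξ j t ω)) h2 hBhj rfl (fun _ => rfl) h1 i hT
  have hKS : ∀ t, Integrable (fun ω => K t + n / p * (t * (t + 1)) * S t ω) P := fun t =>
    (integrable_const _).add ((hS t).1.const_mul _)
  have hfin := weighted_error_le hT (ν := n) (p := p) (δ := δ) (lam := lam)
    (S := ∑ j, l1Norm (x0 j)) (Λ := ∑ j, L j) (Bh := Bh) (C := ∑ j, c j ^ 2)
    (by exact_mod_cast hn) hp hδ hδ1 hlam hlam1 (Finset.sum_nonneg fun j _ => l1Norm_nonneg _) hΛ
    hΛB (Finset.sum_nonneg fun j _ => sq_nonneg _)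
  calc ∫ ω, err ω ∂P
      ≤ ∫ ω, κ * ∑ t ∈ Finset.Icc 1 T, (K t + n / p * (t * (t + 1)) * S t ω) ∂P :=
        integral_mono_ae herr ((integrable_finsetSum _ fun t _ => hKS t).const_mul κ) hpath
    _ = κ * ∑ t ∈ Finset.Icc 1 T, (K t + n / p * (t * (t + 1)) * ∫ ω, S t ω ∂P) := by
        rw [integral_const_mul, integral_finsetSum _ fun t _ => hKS t]
        congr 1
        refine Finset.sum_congr rfl fun t _ => ?_
        rw [integral_add (integrable_const _) ((hS t).1.const_mul _), integral_const_mul]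
        simp
    _ ≤ κ * ∑ t ∈ Finset.Icc 1 T, (K t
          + n / p * (t * (t + 1)) * ((p / n / (t + 1)) ^ 2 * ∑ j, c j ^ 2)) := by
        refine mul_le_mul_of_nonneg_left (Finset.sum_le_sum fun t _ => ?_) hκ0
        gcongr
        exact (hS t).2
    _ = κ * ∑ t ∈ Finset.Icc 1 T, ((t : ℝ) * (5 * (∑ j, L j) * (4 / δ * discountedSum lam
          (∑ j, l1Norm (x0 j)) (fun s => p / (s : ℝ) * (n * Bh)) t))
          + p / n * ((∑ j, L j) ^ 2 + ∑ j, c j ^ 2) * (t / (t + 1))) := by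
        congr 1
        refine Finset.sum_congr rfl fun t _ => ?_
        have e : (n : ℝ) / p * (t * (t + 1)) * ((p / n / (t + 1)) ^ 2 * ∑ j, c j ^ 2)
            = p / n * (∑ j, c j ^ 2) * (t / (t + 1)) := by
          field_simp
        rw [e, hK]
        ring
    _ ≤ _ := hfin
    _ ≤ _ := by
        have h1 : ∑ j, c j ^ 2 ≤ ∑ j, (L j + c j) ^ 2 := Finset.sum_le_sum fun j _ =>
          pow_le_pow_left₀ (hc0 j) (by linarith [hL0 j]) 2
        have h2 : ((T + 1 : ℕ) : ℝ) - 1 = T := by push_cast; ring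
        rw [h2]
        gcongr
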